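/- Let $a_1$ be a nonzero integer and $a_2\in\{1,-1\}$, and let $(u_n)_{n\ge 0}$ be the Lucas sequence $u_0=0$, $u_1=1$, $u_n=a_1u_{n-1}+a_2u_{n-2}$ for $n\ge 2$. Assume that it is non-degenerate, i.e. that the ratio of the roots of $X^2-a_1X-a_2$ is not a root of unity. Put $\Delta=a_1^2+4a_2$, and for every positive integer $m$ let $z(m)$ be the least positive integer $n$ with $m\mid u_n$. Write $\log_k$ for the $k$-fold iterated natural logarithm and $L(t)=t^{\log_3 t/\log_2 t}$. For real $X,Y\ge 1$ let $\Psi(X,Y)$ be the number of positive integers $n\le X$ all of whose prime factors are at most $Y$, and let $\Pi^*(X,Y)$ be the number of primes $p\le X$ such that all prime factors of $p-\left(\frac{\Delta}{p}\right)$ are at most $Y$, where $\left(\frac{\cdot}{p}\right)$ is the Legendre symbol. Assume the following two conjectures for $(u_n)$. (A) As $t\to\infty$, $\#\{n\le t: z(n)=z\}\le t/L(t)^{1+o(1)}$, uniformly in the positive integers $z$. (B) If $X,Y\to\infty$ with $X\ge Y$ and $\dfrac{\log X}{\log Y}=(1+o(1))\sqrt{\log X}$ (that is, $Y=\exp((1+o(1))\sqrt{\log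 X})$), then $\Pi^*(X,Y)\gg \Psi(X,Y)/\log X$. Then for every positive integer $\lambda$, as $x\to\infty$, $$\sum_{n\le x}\gcd(n,u_n)^\lambda = x^{\lambda+1-(1+o(1))\,\log_3 x/\log_2 x}.$$ -/

import Mathlib

open Filter Topology Asymptotics

/-- The Lucas sequence `u_0 = 0`, `u_1 = 1`, `u_n = a₁ u_{n-1} + a₂ u_{n-2}`. -/
def lucasSeq (a₁ a₂ : ℤ) : ℕ → ℤ
  | 0 => 0
  | 1 => 1
  | n + 2 => a₁ * lucasSeq a₁ a₂ (n + 1) + a₂ * lucasSeq a₁ a₂ n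

/-- Standing assumptions on a non-degenerate Lucas sequence: the coefficients are nonzero and
relatively prime, and the ratio of the two complex roots `α, β` of `X² - a₁ X - a₂`
(given by `α + β = a₁`, `α β = -a₂`) is not a root of unity. -/
structure IsNondegenerateLucas (a₁ a₂ : ℤ) : Prop where
  ne_zero₁ : a₁ ≠ 0
  ne_zero₂ : a₂ ≠ 0
  coprime : IsCoprime a₁ a₂
  not_root_of_unity : ∀ α β : ℂ, α + β = (a₁ : ℂ) → α * β = -(a₂ : ℂ) →
    ∀ k : ℕ, 0 < k → (α / β) ^ k ≠ 1

/-- The discriminant `Δ = a₁² + 4 a₂` of `X² - a₁ X - a₂`. -/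
def lucasDisc (a₁ a₂ : ℤ) : ℤ := a₁ ^ 2 + 4 * a₂

/-- The rank of appearance `z(m)`: the least positive `n` with `m ∣ u_n`
(it exists for every positive `m` prime to `a₂`). -/
noncomputable def rankOfAppearance (a₁ a₂ : ℤ) (m : ℕ) : ℕ :=
  sInf {n : ℕ | 0 < n ∧ (m : ℤ) ∣ lucasSeq a₁ a₂ n}

/-- `L(x) = x ^ (log₃ x / log₂ x)`, where `log_k` is the `k`-fold iterated natural logarithm. -/
noncomputable def Lfun (x : ℝ) : ℝ :=
  x ^ (Real.log (Real.log (Real.log x)) / Real.log (Real.log x))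

open Classical in
/-- `#B_z(t)`: the number of positive integers `n ≤ t`, prime to `a₂`, with `z(n) = z`. -/
noncomputable def rankFiberCount (a₁ a₂ : ℤ) (z : ℕ) (t : ℝ) : ℕ :=
  ((Finset.Icc 1 ⌊t⌋₊).filter
    (fun n : ℕ => IsCoprime (n : ℤ) a₂ ∧ rankOfAppearance a₁ a₂ n = z)).card

/-- The Gordon–Pomerance-type conjecture for the given Lucas sequence:
`#B_z(t) ≤ t / L(t)^{1+o(1)}` as `t → ∞`, uniformly in `z`. -/
def GordonPomeranceConjecture (a₁ a₂ : ℤ) : Prop :=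
  ∃ ε : ℝ → ℝ, Tendsto ε atTop (𝓝 0) ∧
    ∀ᶠ t : ℝ in atTop, ∀ z : ℕ, 0 < z →
      (rankFiberCount a₁ a₂ z t : ℝ) ≤ t / Lfun t ^ (1 + ε t)

/-- `P(n) ≤ Y` for a positive integer `n`: every prime factor of `n` is at most `Y`. -/
def IsSmooth (Y : ℝ) (n : ℕ) : Prop :=
  n ≠ 0 ∧ ∀ q : ℕ, q.Prime → q ∣ n → (q : ℝ) ≤ Y

open Classical in
/-- `Ψ(X, Y)`: the number of `Y`-smooth positive integers up to `X`. -/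
noncomputable def smoothCount (X Y : ℝ) : ℕ :=
  ((Finset.Icc 1 ⌊X⌋₊).filter (fun n : ℕ => IsSmooth Y n)).card

open Classical in
/-- `Π*(X, Y)`: the number of primes `p ≤ X` such that the positive integer `p - (Δ/p)` is
`Y`-smooth. At a prime `p` the Jacobi symbol is the Legendre symbol. -/
noncomputable def shiftedSmoothPrimeCount (Δ : ℤ) (X Y : ℝ) : ℕ :=
  ((Finset.Icc 1 ⌊X⌋₊).filter
    (fun p : ℕ => p.Prime ∧ IsSmooth Y ((p : ℤ) - jacobiSym Δ p).toNat)).card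

/-- The conjecture on smooth shifted primes `p - (Δ/p)`: if `X, Y → ∞` (as functions of a
parameter `t → ∞`) with `X ≥ Y` and `U = log X / log Y = (1 + o(1)) √(log X)`, i.e.
`Y = exp ((1 + o(1)) √(log X))`, then `Π*(X, Y) ≫ Ψ(X, Y) / log X`. -/
def SmoothShiftedPrimesConjecture (Δ : ℤ) : Prop :=
  ∀ X Y : ℝ → ℝ, Tendsto X atTop atTop → Tendsto Y atTop atTop →
    (∀ᶠ t in atTop, Y t ≤ X t) →
    Tendsto (fun t => Real.log (X t) / Real.log (Y t) / √(Real.log (X t))) atTop (𝓝 1) →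
    (fun t => (smoothCount (X t) (Y t) : ℝ) / Real.log (X t)) =O[atTop]
      (fun t => (shiftedSmoothPrimeCount Δ (X t) (Y t) : ℝ))

/-!
Write `κ = log₃ x / log₂ x`, so that `L(x) = x ^ κ`, and `z` for the rank of appearance.

**Upper bound.** Put `d = gcd(n, u_n)` and `n = d m`. Then `d ∣ u_{dm}` and `d ^ l ≤ x ^ l / m`, so by
Rankin's method it suffices to bound `∑ d ^ (-c)`, `c = 1 - (1 - o(1)) κ`, over the `d ≤ x / m` with
`d ∣ u_{dm}`, by `x ^ o(κ)`. Build `d` up through the dyadic blocks of its prime factors. A prime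
`p` of the block `[2 ^ i, 2 ^ (i + 1))` not dividing `Δ` has `z(p) ∣ p ± 1`, whose prime factors are
below `2 ^ i`; so if `t` is the `2 ^ i`-smooth part of `d`, then `p ∣ d` forces `p ∣ u_{tm}`
(`exists_layer_decomposition`). Hence each block multiplies the sum by at most
`exp (4 ∑ p ^ (-c))`, the sum being over primes of the block dividing a single `u_G`, `G ≤ x`
(`sum_lucasLayer_le`). The number of these primes is controlled by the conjecture on the fibers of
`z`: the products of `r` distinct ones, `r` chosen so that the products reach about `x`, have rank of
appearance among the `exp (O(log x / log₂ x))` divisors of `G`, and there are too many products if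
there are too many primes (`eventually_card_primes_le`). Blocks of primes below
`exp ((log₂ x) ^ (3 / 2))` are bounded trivially, and the sum over the others is a geometric series.

**Lower bound.** Take `v = (1 - η) log₂ x`, `Y = exp v`, `X = exp (v ^ 2)`. All `Y`-smooth integers up
to `X + 1` divide one integer `M = x ^ o(κ)`, so by the law of apparition every odd prime counted by
`Π*(X, Y)` divides `u_M`. By the second conjecture and the lower bound
`Ψ(X, Y) ≥ X exp (-(1 + o(1)) v log v)` (`eventually_smoothCount_ge`) there are many such primes, and
many of them in one dyadic block, i.e. of nearly equal size (`eventually_exists_dyadic_primes`). For a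
product `d` of `r` of these, `d ∣ gcd(M d, u_{M d})`; choosing `r` so that `M d` is nearly `x` gives
`x ^ (1 - (1 + o(1)) κ)` integers `n ≤ x` with `gcd(n, u_n) ≥ x ^ (1 - o(κ))`
(`choose_mul_le_sum_gcd_pow`).

The lower bound for `Ψ` is obtained by iterating `Ψ(X, Y) log X ≥ ∑_{d ≤ Y} Λ(d) Ψ(X / d, Y)` together
with Mertens' first theorem.
-/

/-! ### Divisibility in Lucas sequences and the law of apparition -/

theorem lucasSeq_zero (a₁ a₂ : ℤ) : lucasSeq a₁ a₂ 0 = 0 := rfl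

theorem lucasSeq_one (a₁ a₂ : ℤ) : lucasSeq a₁ a₂ 1 = 1 := rfl

theorem lucasSeq_add_two (a₁ a₂ : ℤ) (n : ℕ) :
    lucasSeq a₁ a₂ (n + 2) = a₁ * lucasSeq a₁ a₂ (n + 1) + a₂ * lucasSeq a₁ a₂ n := rfl

theorem lucasSeq_add (a₁ a₂ : ℤ) (m n : ℕ) :
    lucasSeq a₁ a₂ (m + n + 1) =
      lucasSeq a₁ a₂ (m + 1) * lucasSeq a₁ a₂ (n + 1) +
        a₂ * lucasSeq a₁ a₂ m * lucasSeq a₁ a₂ n := by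
  induction n using Nat.twoStepInduction with
  | zero => simp [lucasSeq_zero, lucasSeq_one]
  | one =>
    rw [show m + 1 + 1 = m + 2 from rfl, show 1 + 1 = 0 + 2 from rfl, lucasSeq_add_two,
      lucasSeq_add_two, lucasSeq_zero, zero_add, lucasSeq_one]
    ring
  | more k h1 h2 =>
    rw [show m + (k + 2) + 1 = (m + k + 1) + 2 by ring, lucasSeq_add_two,
      show m + k + 1 + 1 = m + (k + 1) + 1 by ring, h1, h2,
      show k + 2 + 1 = k + 1 + 2 by ring, lucasSeq_add_two a₁ a₂ (k + 1),
      lucasSeq_add_two a₁ a₂ k]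
    ring

/-- Consecutive terms are coprime when `a₂` is a unit. -/
theorem isCoprime_lucasSeq_succ {a₁ a₂ : ℤ} (ha : IsUnit a₂) (n : ℕ) :
    IsCoprime (lucasSeq a₁ a₂ n) (lucasSeq a₁ a₂ (n + 1)) := by
  induction n with
  | zero => rw [zero_add, lucasSeq_one]; exact isCoprime_one_right
  | succ k ih =>
    rw [lucasSeq_add_two, add_comm (a₁ * _), mul_comm a₁]
    exact ((isCoprime_mul_unit_left_right ha _ _).2 ih.symm).add_mul_left_right a₁

theorem dvd_lucasSeq_add {a₁ a₂ d : ℤ} {m n : ℕ}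
    (hm : d ∣ lucasSeq a₁ a₂ m) (hn : d ∣ lucasSeq a₁ a₂ n) : d ∣ lucasSeq a₁ a₂ (m + n) := by
  cases n with
  | zero => simpa using hm
  | succ k =>
    rw [← add_assoc, lucasSeq_add]
    exact dvd_add (hn.mul_left _) ((hm.mul_left _).mul_right _)

theorem dvd_lucasSeq_of_add {a₁ a₂ d : ℤ} (ha : IsUnit a₂) {m n : ℕ}
    (hm : d ∣ lucasSeq a₁ a₂ m) (hmn : d ∣ lucasSeq a₁ a₂ (m + n)) :
    d ∣ lucasSeq a₁ a₂ n := by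
  cases n with
  | zero => simp [lucasSeq_zero]
  | succ k =>
    rw [← add_assoc, lucasSeq_add] at hmn
    have h1 : d ∣ lucasSeq a₁ a₂ (m + 1) * lucasSeq a₁ a₂ (k + 1) :=
      (dvd_add_left ((hm.mul_left _).mul_right _)).1 hmn
    exact ((isCoprime_lucasSeq_succ ha m).of_isCoprime_of_dvd_left hm).dvd_of_dvd_mul_left h1

theorem dvd_lucasSeq_mul {a₁ a₂ d : ℤ} {m : ℕ} (hm : d ∣ lucasSeq a₁ a₂ m) (k : ℕ) :
    d ∣ lucasSeq a₁ a₂ (m * k) := by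
  induction k with
  | zero => simp [lucasSeq_zero]
  | succ k ih => rw [mul_add, mul_one]; exact dvd_lucasSeq_add ih hm

theorem dvd_lucasSeq_of_dvd {a₁ a₂ d : ℤ} {m n : ℕ} (hm : d ∣ lucasSeq a₁ a₂ m) (h : m ∣ n) :
    d ∣ lucasSeq a₁ a₂ n := by
  obtain ⟨k, rfl⟩ := h
  exact dvd_lucasSeq_mul hm k

/-- Every positive integer divides some term of positive index: two pairs of consecutive terms
agree modulo `d`, and the recurrence can be run backwards. -/
theorem exists_pos_dvd_lucasSeq {a₁ a₂ : ℤ} (ha : IsUnit a₂) {d : ℕ} (hd : 0 < d) :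
    ∃ n : ℕ, 0 < n ∧ (d : ℤ) ∣ lucasSeq a₁ a₂ n := by
  have : NeZero d := ⟨hd.ne'⟩
  obtain ⟨i, j, hij, he⟩ := Finite.exists_ne_map_eq_of_infinite
    (fun n : ℕ => ((lucasSeq a₁ a₂ n : ZMod d), (lucasSeq a₁ a₂ (n + 1) : ZMod d)))
  wlog hlt : i < j generalizing i j
  · exact this j i hij.symm he.symm (lt_of_le_of_ne (not_lt.1 hlt) hij.symm)
  simp only [Prod.mk.injEq] at he
  obtain ⟨k, rfl⟩ := Nat.exists_eq_add_of_lt hlt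
  refine ⟨k + 1, k.succ_pos, ?_⟩
  obtain ⟨h1, h2⟩ := he
  rw [ZMod.intCast_eq_intCast_iff_dvd_sub] at h1 h2
  clear hlt hij
  induction i with
  | zero => simpa [lucasSeq_zero] using h1
  | succ i ih =>
    refine ih ?_ ?_
    · have h3 : i + 1 + k + 1 + 1 = (i + k + 1) + 2 := by ring
      have h4 : i + 1 + k + 1 = (i + k + 1) + 1 := by ring
      rw [h3, lucasSeq_add_two a₁ a₂ (i + k + 1), lucasSeq_add_two a₁ a₂ i] at h2
      rw [h4] at h1
      have h5 : (d : ℤ) ∣ a₂ * (lucasSeq a₁ a₂ (i + k + 1) - lucasSeq a₁ a₂ i) := by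
        have h6 := dvd_sub h2 (h1.mul_left a₁)
        have h7 : ∀ a b c e : ℤ, a₁ * a + a₂ * b - (a₁ * c + a₂ * e) - a₁ * (a - c)
          = a₂ * (b - e) := fun a b c e => by ring
        rwa [h7] at h6
      exact (ha.dvd_mul_left).1 h5
    · rw [show i + k + 1 + 1 = i + 1 + k + 1 by ring]; exact h1

theorem rankOfAppearance_spec {a₁ a₂ : ℤ} (ha : IsUnit a₂) {d : ℕ} (hd : 0 < d) :
    0 < rankOfAppearance a₁ a₂ d ∧ (d : ℤ) ∣ lucasSeq a₁ a₂ (rankOfAppearance a₁ a₂ d) :=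
  Nat.sInf_mem (s := {n : ℕ | 0 < n ∧ (d : ℤ) ∣ lucasSeq a₁ a₂ n}) (exists_pos_dvd_lucasSeq ha hd)

/-- `d ∣ u_n` exactly when `z(d) ∣ n`, for `a₂ = ±1`. -/
theorem dvd_lucasSeq_iff {a₁ a₂ : ℤ} (ha : IsUnit a₂) {d : ℕ} (hd : 0 < d) (n : ℕ) :
    (d : ℤ) ∣ lucasSeq a₁ a₂ n ↔ rankOfAppearance a₁ a₂ d ∣ n := by
  obtain ⟨h0, h1⟩ := rankOfAppearance_spec (a₁ := a₁) ha hd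
  set z := rankOfAppearance a₁ a₂ d with hz
  refine ⟨fun h => ?_, dvd_lucasSeq_of_dvd h1⟩
  have h2 : (d : ℤ) ∣ lucasSeq a₁ a₂ (n % z) := by
    refine dvd_lucasSeq_of_add ha (dvd_lucasSeq_mul h1 (n / z)) ?_
    rwa [Nat.div_add_mod]
  by_contra h3
  have h4 : 0 < n % z := Nat.pos_of_ne_zero fun h => h3 (Nat.dvd_of_mod_eq_zero h)
  have h5 : z ≤ n % z := Nat.sInf_le ⟨h4, h2⟩
  exact absurd (Nat.mod_lt n h0) (not_lt.2 h5)

/-- Binet's formula, free of division, in any commutative ring containing the roots. -/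
theorem sub_mul_lucasSeq {R : Type*} [CommRing R] {a₁ a₂ : ℤ} {α β : R}
    (hs : α + β = a₁) (hp : α * β = -a₂) (n : ℕ) :
    (α - β) * (lucasSeq a₁ a₂ n : R) = α ^ n - β ^ n := by
  induction n using Nat.twoStepInduction with
  | zero => simp [lucasSeq_zero]
  | one => simp [lucasSeq_one]
  | more k h1 h2 =>
    rw [lucasSeq_add_two]
    push_cast
    have h3 : (α - β) * ((a₁ : R) * (lucasSeq a₁ a₂ (k + 1) : R) + (a₂ : R) * lucasSeq a₁ a₂ k)
        = a₁ * ((α - β) * lucasSeq a₁ a₂ (k + 1)) + a₂ * ((α - β) * lucasSeq a₁ a₂ k) := by ring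
    rw [h3, h1, h2, ← hs, show (a₂ : R) = -(α * β) by rw [hp, neg_neg]]
    ring

/-- The law of apparition, inside a field of characteristic `p` where `Δ` is a square: the
Frobenius map fixes or swaps the two roots. -/
theorem prime_dvd_lucasSeq_of_sq {a₁ a₂ : ℤ} (ha : IsUnit a₂) {p : ℕ} [Fact p.Prime]
    (hp2 : p ≠ 2) {K : Type*} [Field K] [Algebra (ZMod p) K] [CharP K p] {δ : K}
    (hδ : δ ^ 2 = (lucasDisc a₁ a₂ : K)) :
    (p : ℤ) ∣ lucasSeq a₁ a₂ ((p : ℤ) - jacobiSym (lucasDisc a₁ a₂) p).toNat := by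
  have hp : p.Prime := Fact.out
  have key : ∀ n : ℕ, (lucasSeq a₁ a₂ n : K) = 0 → (p : ℤ) ∣ lucasSeq a₁ a₂ n := fun n h =>
    (CharP.intCast_eq_zero_iff K p _).1 h
  have h2 : (2 : K) ≠ 0 := by
    have h : ¬ p ∣ 2 := fun h => hp2 ((Nat.prime_dvd_prime_iff_eq hp Nat.prime_two).1 h)
    intro h'
    exact h ((CharP.cast_eq_zero_iff K p 2).1 (by exact_mod_cast h'))
  have h2p : (2 : K) ^ p = 2 := by
    have := map_pow (algebraMap (ZMod p) K) 2 p
    rw [ZMod.pow_card, map_ofNat] at this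
    exact this.symm
  have hint : ∀ m : ℤ, (m : K) ^ p = m := fun m => by
    have := map_pow (algebraMap (ZMod p) K) (m : ZMod p) p
    rw [ZMod.pow_card, map_intCast] at this
    exact this.symm
  obtain ⟨α, hα⟩ : ∃ α : K, α = (a₁ + δ) / 2 := ⟨_, rfl⟩
  obtain ⟨β, hβ⟩ : ∃ β : K, β = (a₁ - δ) / 2 := ⟨_, rfl⟩
  have hs : α + β = a₁ := by rw [hα, hβ]; field_simp; ring
  have hd : α - β = δ := by rw [hα, hβ]; field_simp; ring
  have hpr : α * β = -a₂ := by
    have : (4 : K) * (α * β) = -(4 * a₂) := by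
      have : 4 * (α * β) = (a₁ : K) ^ 2 - δ ^ 2 := by rw [hα, hβ]; field_simp; ring
      rw [this, hδ, lucasDisc]; push_cast; ring
    have h4 : (4 : K) ≠ 0 := by
      rw [show (4 : K) = 2 * 2 by norm_num]; exact mul_ne_zero h2 h2
    apply mul_left_cancel₀ h4
    rw [this]; ring
  have hbinet := sub_mul_lucasSeq (R := K) hs hpr
  have hab : α * β ≠ 0 := by
    rw [hpr]
    have : IsUnit (a₂ : K) := by
      simpa using ha.map (Int.castRingHom K)
    exact neg_ne_zero.2 this.ne_zero
  have hα0 : α ≠ 0 := left_ne_zero_of_mul hab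
  have hβ0 : β ≠ 0 := right_ne_zero_of_mul hab
  -- Frobenius acts on `δ` through the Legendre symbol, by Euler's criterion.
  have hleg : δ ^ p = (jacobiSym (lucasDisc a₁ a₂) p : ℤ) * δ := by
    have h3 : p = 2 * (p / 2) + 1 := by
      have := (hp.eq_two_or_odd).resolve_left hp2; omega
    rw [← jacobiSym.legendreSym.to_jacobiSym]
    have h4 := legendreSym.eq_pow p (lucasDisc a₁ a₂)
    have h5 : ((legendreSym p (lucasDisc a₁ a₂) : ℤ) : K) = (lucasDisc a₁ a₂ : K) ^ (p / 2) := by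
      have := congrArg (algebraMap (ZMod p) K) h4
      simpa using this
    rw [h5, ← hδ, ← pow_mul, ← pow_succ]
    exact congrArg (δ ^ ·) h3
  have hp1 : 1 ≤ p := hp.one_lt.le
  rcases eq_or_ne (lucasDisc a₁ a₂ : K) 0 with h0 | h0
  · -- A double root `α`: here `u_n = n α ^ (n - 1)`, which vanishes for `n = p`.
    have hδ0 : δ = 0 := by
      rw [h0] at hδ; exact pow_eq_zero_iff (two_ne_zero) |>.1 hδ
    have hJ : jacobiSym (lucasDisc a₁ a₂) p = 0 := by
      rw [← jacobiSym.legendreSym.to_jacobiSym, legendreSym.eq_zero_iff]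
      have : (algebraMap (ZMod p) K) ((lucasDisc a₁ a₂ : ℤ) : ZMod p) = 0 := by simpa using h0
      exact (map_eq_zero _).1 this
    rw [hJ, sub_zero, Int.toNat_natCast]
    have hαβ : α = β := by rw [← sub_eq_zero, hd, hδ0]
    have hu : ∀ n : ℕ, (lucasSeq a₁ a₂ (n + 1) : K) = (n + 1) * α ^ n := by
      intro n
      induction n using Nat.twoStepInduction with
      | zero => simp [lucasSeq_one]
      | one =>
        rw [show 1 + 1 = 0 + 2 from rfl, lucasSeq_add_two, lucasSeq_zero, zero_add, lucasSeq_one]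
        push_cast
        rw [← hs, ← hαβ]; ring
      | more k h1 h2 =>
        rw [show k + 2 + 1 = k + 1 + 2 from rfl, lucasSeq_add_two]
        push_cast at h1 h2 ⊢
        rw [h1, h2, ← hs, show (a₂ : K) = -(α * β) by rw [hpr, neg_neg], ← hαβ]
        ring
    apply key
    obtain ⟨n, hn⟩ : ∃ n, p = n + 1 := ⟨p - 1, by omega⟩
    have h6 := hu n
    have h7 : ((n : K) + 1) = 0 := by
      have := CharP.cast_eq_zero K p
      have h8 : ((n + 1 : ℕ) : K) = (p : K) := congrArg _ hn.symm
      rw [this] at h8; push_cast at h8; exact h8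
    rw [h7, zero_mul, ← hn] at h6
    exact h6
  · have hδ0 : δ ≠ 0 := fun h => h0 (by rw [← hδ, h]; simp)
    have hunit : ((lucasDisc a₁ a₂ : ℤ) : ZMod p) ≠ 0 := fun h => h0 (by
      have := congrArg (algebraMap (ZMod p) K) h
      simpa using this)
    have hfa : α ^ p = (a₁ + δ ^ p) / 2 := by
      rw [hα, div_pow, add_pow_char, hint, h2p]
    have hfb : β ^ p = (a₁ - δ ^ p) / 2 := by
      rw [hβ, div_pow, sub_pow_char, hint, h2p]
    rw [← jacobiSym.legendreSym.to_jacobiSym] at hleg ⊢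
    apply key
    have hfin : ∀ n : ℕ, α ^ n = β ^ n → (lucasSeq a₁ a₂ n : K) = 0 := by
      intro n hn
      have := hbinet n
      rw [hn, sub_self, hd] at this
      exact (mul_eq_zero.1 this).resolve_left hδ0
    apply hfin
    rcases legendreSym.eq_one_or_neg_one p hunit with h | h
    · rw [h] at hleg ⊢
      rw [show ((p : ℤ) - 1).toNat = p - 1 by omega]
      have e1 : α ^ p = α := by rw [hfa, hleg, hα]; simp
      have e2 : β ^ p = β := by rw [hfb, hleg, hβ]; simp
      have f1 : α ^ (p - 1) = 1 := by
        apply mul_right_cancel₀ hα0; rw [← pow_succ, Nat.sub_add_cancel hp1, e1, one_mul]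
      have f2 : β ^ (p - 1) = 1 := by
        apply mul_right_cancel₀ hβ0; rw [← pow_succ, Nat.sub_add_cancel hp1, e2, one_mul]
      rw [f1, f2]
    · rw [h] at hleg ⊢
      rw [show ((p : ℤ) - -1).toNat = p + 1 by omega]
      have e1 : α ^ p = β := by rw [hfa, hleg, hβ]; push_cast; ring
      have e2 : β ^ p = α := by rw [hfb, hleg, hα]; push_cast; ring
      rw [pow_succ, pow_succ, e1, e2, mul_comm]

/-- The law of apparition: an odd prime `p` divides the term of index `p - (Δ/p)`. -/
theorem prime_dvd_lucasSeq {a₁ a₂ : ℤ} (ha : IsUnit a₂) {p : ℕ} (hp : p.Prime) (hp2 : p ≠ 2) :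
    (p : ℤ) ∣ lucasSeq a₁ a₂ ((p : ℤ) - jacobiSym (lucasDisc a₁ a₂) p).toNat := by
  have : Fact p.Prime := ⟨hp⟩
  obtain ⟨δ, hδ⟩ := IsAlgClosed.exists_pow_nat_eq
    (lucasDisc a₁ a₂ : AlgebraicClosure (ZMod p)) (n := 2) (by norm_num)
  exact prime_dvd_lucasSeq_of_sq ha hp2 hδ

theorem IsNondegenerateLucas.lucasDisc_ne_zero {a₁ a₂ : ℤ} (h : IsNondegenerateLucas a₁ a₂) :
    lucasDisc a₁ a₂ ≠ 0 := by
  intro h0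
  have hc : (a₁ : ℂ) ^ 2 + 4 * a₂ = 0 := by
    have := congrArg (Int.cast : ℤ → ℂ) h0
    simpa [lucasDisc] using this
  have h1 := h.not_root_of_unity (a₁ / 2) (a₁ / 2) (by ring) (by linear_combination hc / 4) 1
    one_pos
  apply h1
  have : (a₁ : ℂ) ≠ 0 := by exact_mod_cast h.ne_zero₁
  rw [pow_one]
  field_simp

/-- A prime factor of `z(p)` divides `p - 1` or `p + 1`, both even, so it is at most `(p + 1) / 2`:
it lies in a lower dyadic block than `p`. -/
theorem lt_two_pow_of_dvd_rankOfAppearance {a₁ a₂ : ℤ} (ha : IsUnit a₂) {p q i : ℕ}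
    (hp : p.Prime) (hi : 2 ≤ i) (hpi : 2 ^ i ≤ p) (hpi' : p < 2 ^ (i + 1))
    (hpD : ¬ (p : ℤ) ∣ lucasDisc a₁ a₂)
    (hq : q.Prime) (hqz : q ∣ rankOfAppearance a₁ a₂ p) : q < 2 ^ i := by
  have : Fact p.Prime := ⟨hp⟩
  have h4 : 2 ^ 2 ≤ 2 ^ i := Nat.pow_le_pow_right (by norm_num) hi
  have hp2 : p ≠ 2 := by rintro rfl; omega
  have h1 := (dvd_lucasSeq_iff (a₁ := a₁) ha hp.pos _).1 (prime_dvd_lucasSeq ha hp hp2)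
  have h2 := hqz.trans h1
  have hodd := (hp.eq_two_or_odd).resolve_left hp2
  have hunit : ((lucasDisc a₁ a₂ : ℤ) : ZMod p) ≠ 0 := fun h =>
    hpD ((ZMod.intCast_zmod_eq_zero_iff_dvd _ _).1 h)
  rw [← jacobiSym.legendreSym.to_jacobiSym] at h2
  obtain ⟨n, hn0, hn1, hn2, hqn⟩ : ∃ n, 0 < n ∧ n % 2 = 0 ∧ n ≤ p + 1 ∧ q ∣ n := by
    rcases legendreSym.eq_one_or_neg_one p hunit with h | h
    · rw [h, show ((p : ℤ) - 1).toNat = p - 1 by omega] at h2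
      exact ⟨p - 1, by omega, by omega, by omega, h2⟩
    · rw [h, show ((p : ℤ) - -1).toNat = p + 1 by omega] at h2
      exact ⟨p + 1, by omega, by omega, le_rfl, h2⟩
  rw [pow_succ] at hpi'
  have hne : q ≠ 2 ^ i := by
    rintro rfl
    exact Nat.Prime.not_prime_pow hi hq
  obtain ⟨k, rfl⟩ := hqn
  rcases Nat.lt_or_ge k 2 with hk | hk
  · interval_cases k
    · omega
    · have : q = 2 := by
        rcases hq.eq_two_or_odd with h | h
        · exact h
        · omega
      omega
  · have : q * 2 ≤ q * k := Nat.mul_le_mul_left _ hk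
    omega

/-! ### Rankin's method along dyadic layers of primes -/

theorem inv_one_sub_le_exp {t : ℝ} (h0 : 0 ≤ t) (h1 : t ≤ 3 / 4) : (1 - t)⁻¹ ≤ Real.exp (4 * t) := by
  have h2 := Real.quadratic_le_exp_of_nonneg (x := 4 * t) (by linarith)
  rw [inv_le_iff_one_le_mul₀ (by linarith)]
  have h3 : 0 ≤ t * (3 / 4 - t) := mul_nonneg h0 (by linarith)
  nlinarith [mul_nonneg h0 h3]

theorem natCast_rpow_neg_le {c : ℝ} (hc : 1 / 2 ≤ c) {p : ℕ} (hp : 2 ≤ p) :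
    (p : ℝ) ^ (-c) ≤ 3 / 4 := by
  have hp' : (2 : ℝ) ≤ p := by exact_mod_cast hp
  calc (p : ℝ) ^ (-c) ≤ (p : ℝ) ^ (-(1 / 2) : ℝ) :=
        Real.rpow_le_rpow_of_exponent_le (by linarith) (by linarith)
    _ ≤ (2 : ℝ) ^ (-(1 / 2) : ℝ) :=
        Real.rpow_le_rpow_of_nonpos (by norm_num) hp' (by norm_num)
    _ = (√2)⁻¹ := by rw [Real.rpow_neg (by norm_num), Real.sqrt_eq_rpow]
    _ ≤ 3 / 4 := by
        rw [inv_le_comm₀ (by positivity) (by norm_num)]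
        exact Real.le_sqrt_of_sq_le (by norm_num)

/-- Euler product bound for a Dirichlet sum over the integers composed of a given finite set of
primes. -/
theorem sum_factoredNumbers_rpow_le {c : ℝ} (hc : 1 / 2 ≤ c) {P A : Finset ℕ}
    (hP : ∀ p ∈ P, p.Prime) (hA : ∀ f ∈ A, f ∈ Nat.factoredNumbers P) :
    ∑ f ∈ A, (f : ℝ) ^ (-c) ≤ Real.exp (4 * ∑ p ∈ P, (p : ℝ) ^ (-c)) := by
  let φ : ℕ →* ℝ :=
    { toFun := fun n => (n : ℝ) ^ (-c)
      map_one' := by simp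
      map_mul' := fun a b => by
        push_cast; exact Real.mul_rpow (Nat.cast_nonneg _) (Nat.cast_nonneg _) }
  have hφ : ∀ n : ℕ, 0 ≤ φ n := fun n => Real.rpow_nonneg (Nat.cast_nonneg _) _
  have hlt : ∀ {p : ℕ}, p.Prime → ‖φ p‖ < 1 := fun {p} hp => by
    rw [Real.norm_of_nonneg (hφ p)]
    have := natCast_rpow_neg_le hc hp.two_le
    exact lt_of_le_of_lt this (by norm_num)
  obtain ⟨hs, hsum⟩ := EulerProduct.summable_and_hasSum_factoredNumbers_prod_filter_prime_geometric
    (f := φ) hlt P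
  have h1 : ∑ f ∈ A, φ f ≤ ∏ p ∈ P with p.Prime, (1 - φ p)⁻¹ := by
    have := sum_le_hasSum (A.subtype (· ∈ Nat.factoredNumbers P)) (fun i _ => hφ i) hsum
    rwa [Finset.sum_subtype_of_mem (fun n => φ n) hA] at this
  refine h1.trans ?_
  rw [Finset.filter_true_of_mem hP, Finset.mul_sum, Real.exp_sum]
  refine Finset.prod_le_prod (fun p hp => ?_) (fun p hp => ?_)
  · have := natCast_rpow_neg_le hc (hP p hp).two_le
    have h : φ p = (p : ℝ) ^ (-c) := rfl
    rw [inv_nonneg, h]; linarith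
  · exact inv_one_sub_le_exp (hφ p) (natCast_rpow_neg_le hc (hP p hp).two_le)

open Classical in
/-- The `2 ^ i`-smooth integers `t ≤ N` all of whose prime factors `p ≥ 2 ^ j` divide the term of
index `t * m`. For `t = gcd(n, u_n)` and `n = t * m` this condition holds. -/
noncomputable def lucasLayer (a₁ a₂ : ℤ) (m j N i : ℕ) : Finset ℕ :=
  (Finset.Icc 1 N).filter fun t => t ∈ Nat.smoothNumbers (2 ^ i) ∧
    ∀ p : ℕ, p.Prime → p ∣ t → 2 ^ j ≤ p → (p : ℤ) ∣ lucasSeq a₁ a₂ (t * m)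

open Classical in
/-- The primes in the dyadic block `[2 ^ i, 2 ^ (i + 1))` which, when `j ≤ i`, divide the term of
index `G`. -/
noncomputable def lucasBlock (a₁ a₂ : ℤ) (j i G : ℕ) : Finset ℕ :=
  (Finset.Ico (2 ^ i) (2 ^ (i + 1))).filter fun p => p.Prime ∧
    (j ≤ i → (p : ℤ) ∣ lucasSeq a₁ a₂ G)

theorem exists_smooth_mul_rough (y n : ℕ) (hn : n ≠ 0) :
    ∃ t f : ℕ, n = t * f ∧ (∀ p : ℕ, p.Prime → p ∣ t → p < y) ∧
      ∀ p : ℕ, p.Prime → p ∣ f → y ≤ p := by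
  refine ⟨∏ p ∈ n.primeFactors with p < y, p ^ n.factorization p,
    ∏ p ∈ n.primeFactors with ¬ p < y, p ^ n.factorization p, ?_, ?_, ?_⟩
  · rw [Finset.prod_filter_mul_prod_filter_not]
    exact (Nat.prod_factorization_pow_eq_self hn).symm
  · intro p hp h
    obtain ⟨q, hq, hpq⟩ := (hp.prime.dvd_finsetProd_iff _).1 h
    rw [Finset.mem_filter] at hq
    have := (Nat.prime_dvd_prime_iff_eq hp (Nat.prime_of_mem_primeFactors hq.1)).1
      (hp.dvd_of_dvd_pow hpq)
    exact this ▸ hq.2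
  · intro p hp h
    obtain ⟨q, hq, hpq⟩ := (hp.prime.dvd_finsetProd_iff _).1 h
    rw [Finset.mem_filter] at hq
    have := (Nat.prime_dvd_prime_iff_eq hp (Nat.prime_of_mem_primeFactors hq.1)).1
      (hp.dvd_of_dvd_pow hpq)
    exact this ▸ not_lt.1 hq.2

/-- Every element of a layer is an element of the previous layer times an integer composed of
primes of the corresponding block. This is where the smallness of the prime factors of `z(p)` is
used: for `p` in the block `[2 ^ i, 2 ^ (i + 1))`, `z(p)` is coprime to the `2 ^ i`-rough part. -/
theorem exists_layer_decomposition {a₁ a₂ : ℤ} (ha : IsUnit a₂) (hD : lucasDisc a₁ a₂ ≠ 0)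
    {m j N i : ℕ} (hj : 2 ≤ j) (hjD : (lucasDisc a₁ a₂).natAbs < 2 ^ j)
    {n : ℕ} (hn : n ∈ lucasLayer a₁ a₂ m j N (i + 1)) :
    ∃ t f : ℕ, n = t * f ∧ t ∈ lucasLayer a₁ a₂ m j N i ∧ f ∈ Finset.Icc 1 N ∧
      f ∈ Nat.factoredNumbers (lucasBlock a₁ a₂ j i (t * m)) := by
  classical
  simp only [lucasLayer, Finset.mem_filter, Finset.mem_Icc] at hn
  obtain ⟨⟨hn1, hnN⟩, hns, hnd⟩ := hn
  obtain ⟨t, f, rfl, ht, hf⟩ := exists_smooth_mul_rough (2 ^ i) n (by omega)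
  have ht0 : 0 < t := Nat.pos_of_mul_pos_right hn1
  have hf0 : 0 < f := Nat.pos_of_mul_pos_left hn1
  have htN : t ≤ N := (Nat.le_mul_of_pos_right t hf0).trans hnN
  have hfN : f ≤ N := (Nat.le_mul_of_pos_left f ht0).trans hnN
  have hnt : ∀ p : ℕ, p.Prime → p ∣ t * f → p < 2 ^ (i + 1) := Nat.mem_smoothNumbers'.1 hns
  have key : ∀ p : ℕ, p.Prime → p ∣ t * f → 2 ^ j ≤ p → (p : ℤ) ∣ lucasSeq a₁ a₂ (t * m) := by
    intro p hp hpn hpj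
    have h1 := (dvd_lucasSeq_iff ha hp.pos _).1 (hnd p hp hpn hpj)
    rw [dvd_lucasSeq_iff ha hp.pos]
    rw [show t * f * m = t * m * f by ring] at h1
    refine Nat.Coprime.dvd_of_dvd_mul_right ?_ h1
    refine Nat.coprime_of_dvd fun q hq hqz hqf => ?_
    have hp0 := hp.ne_zero
    have hlog : j ≤ Nat.log 2 p := (Nat.le_log_iff_pow_le (by norm_num) hp0).2 hpj
    have hlog' : Nat.log 2 p < i + 1 := Nat.log_lt_of_lt_pow hp0 (hnt p hp hpn)
    have h2 := lt_two_pow_of_dvd_rankOfAppearance ha hp (hj.trans hlog)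
      (Nat.pow_log_le_self 2 hp0) (Nat.lt_pow_succ_log_self (by norm_num) p)
      (fun h => by
        have := Nat.le_of_dvd (Int.natAbs_pos.2 hD) (Int.natCast_dvd.1 h)
        omega) hq hqz
    have h3 : 2 ^ Nat.log 2 p ≤ 2 ^ i := Nat.pow_le_pow_right (by norm_num) (by omega)
    have h4 := hf q hq hqf
    omega
  refine ⟨t, f, rfl, ?_, Finset.mem_Icc.2 ⟨hf0, hfN⟩, ?_⟩
  · simp only [lucasLayer, Finset.mem_filter, Finset.mem_Icc]
    exact ⟨⟨ht0, htN⟩, Nat.mem_smoothNumbers'.2 ht, fun p hp hpt => key p hp (hpt.mul_right f)⟩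
  · rw [Nat.mem_factoredNumbers']
    intro p hp hpf
    simp only [lucasBlock, Finset.mem_filter, Finset.mem_Ico]
    exact ⟨⟨hf p hp hpf, hnt p hp (hpf.mul_left t)⟩, hp, fun hji =>
      key p hp (hpf.mul_left t) ((Nat.pow_le_pow_right (by norm_num) hji).trans (hf p hp hpf))⟩

theorem sum_lucasLayer_succ_le {a₁ a₂ : ℤ} (ha : IsUnit a₂) (hD : lucasDisc a₁ a₂ ≠ 0)
    {m j N i : ℕ} (hj : 2 ≤ j) (hjD : (lucasDisc a₁ a₂).natAbs < 2 ^ j)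
    {c s : ℝ} (hc : 1 / 2 ≤ c)
    (hs : ∀ t ∈ lucasLayer a₁ a₂ m j N i,
      ∑ p ∈ lucasBlock a₁ a₂ j i (t * m), (p : ℝ) ^ (-c) ≤ s) :
    ∑ n ∈ lucasLayer a₁ a₂ m j N (i + 1), (n : ℝ) ^ (-c) ≤
      Real.exp (4 * s) * ∑ t ∈ lucasLayer a₁ a₂ m j N i, (t : ℝ) ^ (-c) := by
  classical
  let F : ℕ → Finset ℕ := fun t => (Finset.Icc 1 N).filter
    fun f => f ∈ Nat.factoredNumbers (lucasBlock a₁ a₂ j i (t * m))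
  have hpos : ∀ n : ℕ, 0 ≤ (n : ℝ) ^ (-c) := fun n => Real.rpow_nonneg (Nat.cast_nonneg _) _
  have hsub : lucasLayer a₁ a₂ m j N (i + 1) ⊆
      ((lucasLayer a₁ a₂ m j N i).sigma F).image fun x : (_ : ℕ) × ℕ => x.1 * x.2 := by
    intro n hn
    obtain ⟨t, f, rfl, ht, hf, hf'⟩ := exists_layer_decomposition ha hD hj hjD hn
    exact Finset.mem_image.2 ⟨⟨t, f⟩, Finset.mem_sigma.2 ⟨ht, Finset.mem_filter.2 ⟨hf, hf'⟩⟩, rfl⟩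
  calc ∑ n ∈ lucasLayer a₁ a₂ m j N (i + 1), (n : ℝ) ^ (-c)
      ≤ ∑ n ∈ ((lucasLayer a₁ a₂ m j N i).sigma F).image fun x : (_ : ℕ) × ℕ => x.1 * x.2, (n : ℝ) ^ (-c) :=
        Finset.sum_le_sum_of_subset_of_nonneg hsub fun n _ _ => hpos n
    _ ≤ ∑ x ∈ (lucasLayer a₁ a₂ m j N i).sigma F, ((x.1 * x.2 : ℕ) : ℝ) ^ (-c) :=
        Finset.sum_image_le_of_nonneg (f := fun n : ℕ => (n : ℝ) ^ (-c)) fun n _ => hpos n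
    _ = ∑ t ∈ lucasLayer a₁ a₂ m j N i, (t : ℝ) ^ (-c) * ∑ f ∈ F t, (f : ℝ) ^ (-c) := by
        rw [Finset.sum_sigma]
        refine Finset.sum_congr rfl fun t _ => ?_
        rw [Finset.mul_sum]
        refine Finset.sum_congr rfl fun f _ => ?_
        push_cast
        exact Real.mul_rpow (Nat.cast_nonneg _) (Nat.cast_nonneg _)
    _ ≤ ∑ t ∈ lucasLayer a₁ a₂ m j N i, (t : ℝ) ^ (-c) * Real.exp (4 * s) := by
        refine Finset.sum_le_sum fun t ht => mul_le_mul_of_nonneg_left ?_ (hpos t)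
        refine (sum_factoredNumbers_rpow_le hc (P := lucasBlock a₁ a₂ j i (t * m)) ?_ ?_).trans ?_
        · intro p hp
          exact (Finset.mem_filter.1 hp).2.1
        · intro f hf
          exact (Finset.mem_filter.1 hf).2
        · exact Real.exp_le_exp.2 (by linarith [hs t ht])
    _ = _ := by rw [← Finset.sum_mul, mul_comm]

/-- The layer at `0` is `{1}`, so iterating over the blocks bounds the Dirichlet sum over a layer. -/
theorem sum_lucasLayer_le {a₁ a₂ : ℤ} (ha : IsUnit a₂) (hD : lucasDisc a₁ a₂ ≠ 0)
    {m j N : ℕ} (hj : 2 ≤ j) (hjD : (lucasDisc a₁ a₂).natAbs < 2 ^ j)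
    {c : ℝ} (hc : 1 / 2 ≤ c) {s : ℕ → ℝ} (I : ℕ)
    (hs : ∀ i < I, ∀ t ∈ lucasLayer a₁ a₂ m j N i,
      ∑ p ∈ lucasBlock a₁ a₂ j i (t * m), (p : ℝ) ^ (-c) ≤ s i) :
    ∑ n ∈ lucasLayer a₁ a₂ m j N I, (n : ℝ) ^ (-c) ≤
      Real.exp (4 * ∑ i ∈ Finset.range I, s i) := by
  induction I with
  | zero =>
    have hsub : lucasLayer a₁ a₂ m j N 0 ⊆ {1} := by
      classical
      intro n hn
      rw [lucasLayer] at hn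
      have := (Finset.mem_filter.1 hn).2.1
      simpa using this
    refine (Finset.sum_le_sum_of_subset_of_nonneg hsub
      fun n _ _ => Real.rpow_nonneg (Nat.cast_nonneg _) _).trans ?_
    simp
  | succ I ih =>
    refine (sum_lucasLayer_succ_le ha hD hj hjD hc (hs I (Nat.lt_succ_self I))).trans ?_
    rw [Finset.sum_range_succ, mul_add, Real.exp_add, mul_comm]
    exact mul_le_mul_of_nonneg_right (ih fun i hi => hs i (hi.trans (Nat.lt_succ_self I)))
      (Real.exp_pos _).le

/-- Rankin's method for the moment: with `d = gcd(n, u_n)` and `n = d * m`, one has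
`d ^ l ≤ N ^ l / m` and `1 ≤ N ^ c * d ^ (-c)`. -/
theorem sum_gcd_pow_le {a₁ a₂ : ℤ} {l j N I : ℕ} (hl : 0 < l) (hNI : N < 2 ^ I)
    {c W : ℝ} (hc : 0 ≤ c) (hW : 0 ≤ W)
    (hsum : ∀ m ∈ Finset.Icc 1 N,
      ∑ n ∈ lucasLayer a₁ a₂ m j (N / m) I, (n : ℝ) ^ (-c) ≤ W) :
    ∑ n ∈ Finset.Icc 1 N, (Int.gcd (n : ℤ) (lucasSeq a₁ a₂ n) : ℝ) ^ l ≤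
      (N : ℝ) ^ ((l : ℝ) + c) * W * (1 + Real.log N) := by
  classical
  let g : ℕ → ℕ := fun n => Int.gcd (n : ℤ) (lucasSeq a₁ a₂ n)
  rcases Nat.eq_zero_or_pos N with rfl | hN
  · simp only [Finset.Icc_eq_empty (show ¬ (1 ≤ 0) by omega), Finset.sum_empty]
    simp only [CharP.cast_eq_zero, Real.log_zero]
    positivity
  have hN0 : (0 : ℝ) < N := by exact_mod_cast hN
  have hterm : ∀ n ∈ Finset.Icc 1 N, (g n : ℝ) ^ l ≤
      (N : ℝ) ^ ((l : ℝ) + c) * ((((n / g n : ℕ) : ℝ))⁻¹ * (g n : ℝ) ^ (-c)) := by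
    intro n hn
    rw [Finset.mem_Icc] at hn
    have hg : g n ∣ n := by exact_mod_cast Int.gcd_dvd_left (n : ℤ) (lucasSeq a₁ a₂ n)
    have hg0 : 0 < g n := Nat.pos_of_dvd_of_pos hg (by omega)
    obtain ⟨m, hm⟩ := hg
    have hm0 : 0 < m := by
      rcases Nat.eq_zero_or_pos m with rfl | h
      · omega
      · exact h
    have hm' : n / g n = m := by
      exact Nat.div_eq_of_eq_mul_right hg0 hm
    rw [hm']
    have hgm : (g n : ℝ) * m ≤ N := by
      have : g n * m ≤ N := by omega
      exact_mod_cast this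
    have hgR : (0 : ℝ) < g n := by exact_mod_cast hg0
    have hmR : (1 : ℝ) ≤ m := by exact_mod_cast hm0
    have hgN : (g n : ℝ) ≤ N := by nlinarith
    have h1 : (g n : ℝ) ^ l * m ≤ (N : ℝ) ^ l := by
      obtain ⟨k, rfl⟩ : ∃ k, l = k + 1 := ⟨l - 1, by omega⟩
      rw [pow_succ, pow_succ, mul_assoc]
      exact mul_le_mul (pow_le_pow_left₀ hgR.le hgN k) hgm (by positivity) (by positivity)
    have h2 : 1 ≤ (N : ℝ) ^ c * (g n : ℝ) ^ (-c) := by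
      rw [Real.rpow_neg hgR.le, ← div_eq_mul_inv, one_le_div (by positivity)]
      exact Real.rpow_le_rpow hgR.le hgN hc
    rw [Real.rpow_add hN0, Real.rpow_natCast]
    calc (g n : ℝ) ^ l ≤ (N : ℝ) ^ l * (m : ℝ)⁻¹ := by
          rw [← div_eq_mul_inv, le_div_iff₀ (by linarith)]; exact h1
      _ ≤ (N : ℝ) ^ l * (m : ℝ)⁻¹ * ((N : ℝ) ^ c * (g n : ℝ) ^ (-c)) :=
          le_mul_of_one_le_right (by positivity) h2
      _ = _ := by ring
  have hpos : ∀ x : (_ : ℕ) × ℕ, 0 ≤ ((x.1 : ℝ))⁻¹ * (x.2 : ℝ) ^ (-c) := fun x => by positivity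
  have hmap : ∑ n ∈ Finset.Icc 1 N, ((((n / g n : ℕ) : ℝ))⁻¹ * (g n : ℝ) ^ (-c)) ≤
      ∑ x ∈ (Finset.Icc 1 N).sigma fun m => lucasLayer a₁ a₂ m j (N / m) I,
        ((x.1 : ℝ))⁻¹ * (x.2 : ℝ) ^ (-c) := by
    have hmem : ∀ n ∈ Finset.Icc 1 N, (⟨n / g n, g n⟩ : (_ : ℕ) × ℕ) ∈
        (Finset.Icc 1 N).sigma fun m => lucasLayer a₁ a₂ m j (N / m) I := by
      intro n hn
      rw [Finset.mem_Icc] at hn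
      have hg : g n ∣ n := by exact_mod_cast Int.gcd_dvd_left (n : ℤ) (lucasSeq a₁ a₂ n)
      have hg0 : 0 < g n := Nat.pos_of_dvd_of_pos hg (by omega)
      have hm0 : 0 < n / g n := Nat.div_pos (Nat.le_of_dvd (by omega) hg) hg0
      have hgn : g n ≤ n := Nat.le_of_dvd (by omega) hg
      simp only [Finset.mem_sigma, Finset.mem_Icc, lucasLayer, Finset.mem_filter]
      refine ⟨⟨hm0, (Nat.div_le_self _ _).trans hn.2⟩, ⟨hg0, ?_⟩,
        Nat.mem_smoothNumbers_of_lt hg0 (by omega), fun p hp hpg _ => ?_⟩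
      · rw [Nat.le_div_iff_mul_le hm0, Nat.mul_div_cancel' hg]; exact hn.2
      · rw [Nat.mul_div_cancel' hg]
        have h3 : (g n : ℤ) ∣ lucasSeq a₁ a₂ n := Int.gcd_dvd_right _ _
        exact (Int.natCast_dvd_natCast.2 hpg).trans h3
    have hinj : Set.InjOn (fun n : ℕ => (⟨n / g n, g n⟩ : (_ : ℕ) × ℕ)) (Finset.Icc 1 N) := by
      intro n hn n' hn' h
      have hg : ∀ n, g n ∣ n := fun n => by
        exact_mod_cast Int.gcd_dvd_left (n : ℤ) (lucasSeq a₁ a₂ n)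
      simp only [Sigma.mk.injEq, heq_eq_eq] at h
      rw [← Nat.div_mul_cancel (hg n), ← Nat.div_mul_cancel (hg n'), h.1, h.2]
    rw [← Finset.sum_image (g := fun n : ℕ => (⟨n / g n, g n⟩ : (_ : ℕ) × ℕ))
      (f := fun x : (_ : ℕ) × ℕ => ((x.1 : ℝ))⁻¹ * (x.2 : ℝ) ^ (-c)) hinj]
    refine Finset.sum_le_sum_of_subset_of_nonneg ?_ fun x _ _ => hpos x
    intro x hx
    obtain ⟨n, hn, rfl⟩ := Finset.mem_image.1 hx
    exact hmem n hn
  have hharm : ∑ m ∈ Finset.Icc 1 N, ((m : ℝ))⁻¹ ≤ 1 + Real.log N := by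
    have := harmonic_le_one_add_log N
    rw [harmonic_eq_sum_Icc] at this
    push_cast at this
    exact this
  calc ∑ n ∈ Finset.Icc 1 N, (g n : ℝ) ^ l
      ≤ ∑ n ∈ Finset.Icc 1 N,
        (N : ℝ) ^ ((l : ℝ) + c) * ((((n / g n : ℕ) : ℝ))⁻¹ * (g n : ℝ) ^ (-c)) :=
        Finset.sum_le_sum hterm
    _ = (N : ℝ) ^ ((l : ℝ) + c) *
        ∑ n ∈ Finset.Icc 1 N, ((((n / g n : ℕ) : ℝ))⁻¹ * (g n : ℝ) ^ (-c)) := by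
        rw [Finset.mul_sum]
    _ ≤ (N : ℝ) ^ ((l : ℝ) + c) * (W * (1 + Real.log N)) := by
        refine mul_le_mul_of_nonneg_left (hmap.trans ?_) (by positivity)
        rw [Finset.sum_sigma]
        calc _ ≤ ∑ m ∈ Finset.Icc 1 N, ((m : ℝ))⁻¹ * W := by
              refine Finset.sum_le_sum fun m hm => ?_
              have := mul_le_mul_of_nonneg_left (hsum m hm)
                (show (0 : ℝ) ≤ ((m : ℝ))⁻¹ by positivity)
              rwa [Finset.mul_sum] at this
          _ ≤ _ := by
              rw [← Finset.sum_mul, mul_comm]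
              exact mul_le_mul_of_nonneg_left hharm hW
    _ = _ := by ring

/-! ### Divisors, and primes with a prescribed multiple of the rank of appearance -/

/-- The exponent `log₃ x / log₂ x`. -/
noncomputable def logRatio (x : ℝ) : ℝ :=
  Real.log (Real.log (Real.log x)) / Real.log (Real.log x)

theorem tendsto_log_log : Tendsto (fun x : ℝ => Real.log (Real.log x)) atTop atTop :=
  Real.tendsto_log_atTop.comp Real.tendsto_log_atTop

theorem tendsto_log_div_self : Tendsto (fun x : ℝ => Real.log x / x) atTop (𝓝 0) :=
  (Real.isLittleO_log_id_atTop).tendsto_div_nhds_zero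

theorem tendsto_logRatio : Tendsto logRatio atTop (𝓝 0) :=
  tendsto_log_div_self.comp tendsto_log_log

theorem eventually_logRatio_pos : ∀ᶠ x : ℝ in atTop, 0 < logRatio x := by
  filter_upwards [tendsto_log_log.eventually_gt_atTop 1] with x hx
  exact div_pos (Real.log_pos hx) (by linarith)

/-- If all primes of `P` divide `u_G`, then the products of `r` distinct primes of `P` divide `u_G`, so
their rank of appearance is one of the divisors of `G`. -/
theorem choose_card_le {a₁ a₂ : ℤ} (ha : IsUnit a₂) {P : Finset ℕ} (hP : ∀ p ∈ P, p.Prime)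
    {y r G : ℕ} (hG : 0 < G) (hPy : ∀ p ∈ P, p ≤ y)
    (hPG : ∀ p ∈ P, (p : ℤ) ∣ lucasSeq a₁ a₂ G) {B : ℝ}
    (hB : ∀ z : ℕ, 0 < z → (rankFiberCount a₁ a₂ z ((y ^ r : ℕ) : ℝ) : ℝ) ≤ B) :
    ((P.card.choose r : ℕ) : ℝ) ≤ G.divisors.card * B := by
  classical
  let fib : ℕ → Finset ℕ := fun z => (Finset.Icc 1 ⌊((y ^ r : ℕ) : ℝ)⌋₊).filter
    (fun n : ℕ => IsCoprime (n : ℤ) a₂ ∧ rankOfAppearance a₁ a₂ n = z)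
  have hfib : ∀ z, rankFiberCount a₁ a₂ z ((y ^ r : ℕ) : ℝ) = (fib z).card := fun z => by
    rw [rankFiberCount]
  have hinj : Set.InjOn (fun s : Finset ℕ => ∏ p ∈ s, p) (P.powersetCard r) := by
    intro s hs t ht h
    rw [Finset.mem_coe, Finset.mem_powersetCard] at hs ht
    rw [← Nat.primeFactors_prod fun p hp => hP p (hs.1 hp),
      ← Nat.primeFactors_prod fun p hp => hP p (ht.1 hp)]
    exact congrArg _ h
  have hsub : (P.powersetCard r).image (fun s : Finset ℕ => ∏ p ∈ s, p) ⊆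
      G.divisors.biUnion fib := by
    intro n hn
    obtain ⟨s, hs, rfl⟩ := Finset.mem_image.1 hn
    rw [Finset.mem_powersetCard] at hs
    have hpos : 0 < ∏ p ∈ s, p := Finset.prod_pos fun p hp => (hP p (hs.1 hp)).pos
    have hle : ∏ p ∈ s, p ≤ y ^ r := by
      rw [← hs.2]
      exact Finset.prod_le_pow_card _ _ _ fun p hp => hPy p (hs.1 hp)
    have hdvd : ((∏ p ∈ s, p : ℕ) : ℤ) ∣ lucasSeq a₁ a₂ G := by
      rw [Int.natCast_dvd]
      exact Finset.prod_primes_dvd _ (fun p hp => (hP p (hs.1 hp)).prime)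
        fun p hp => Int.natCast_dvd.1 (hPG p (hs.1 hp))
    rw [Finset.mem_biUnion]
    refine ⟨rankOfAppearance a₁ a₂ (∏ p ∈ s, p),
      Nat.mem_divisors.2 ⟨(dvd_lucasSeq_iff ha hpos _).1 hdvd, hG.ne'⟩, ?_⟩
    obtain ⟨v, hv⟩ := ha.exists_left_inv
    refine Finset.mem_filter.2 ⟨Finset.mem_Icc.2 ⟨hpos, ?_⟩, ⟨0, v, by rw [hv]; ring⟩, rfl⟩
    rw [Nat.floor_natCast]
    exact hle
  have hcard := Finset.card_le_card hsub
  rw [Finset.card_image_of_injOn hinj, Finset.card_powersetCard] at hcard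
  calc ((P.card.choose r : ℕ) : ℝ) ≤ ((∑ z ∈ G.divisors, (fib z).card : ℕ) : ℝ) := by
        exact_mod_cast hcard.trans Finset.card_biUnion_le
    _ = ∑ z ∈ G.divisors, ((fib z).card : ℝ) := by push_cast; rfl
    _ ≤ ∑ z ∈ G.divisors, B := by
        refine Finset.sum_le_sum fun z hz => ?_
        rw [← hfib]
        exact hB z (Nat.pos_of_mem_divisors hz)
    _ = _ := by rw [Finset.sum_const, nsmul_eq_mul]

/-- The prime factors below `B` contribute at most `(log₂ n + 1) ^ B` to the number of divisors,
the others at most `2 ^ (log n / log B)`. -/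
theorem card_divisors_le_exp {B n : ℕ} (hB : 2 ≤ B) (hn : 0 < n) :
    (n.divisors.card : ℝ) ≤
      Real.exp (B * Real.log (Nat.log 2 n + 1) + Real.log 2 * (Real.log n / Real.log B)) := by
  classical
  have hB0 : (0 : ℝ) < B := by positivity
  have hlB : 0 < Real.log B := Real.log_pos (by exact_mod_cast hB)
  rw [Nat.card_divisors hn.ne', ← Finset.prod_filter_mul_prod_filter_not n.primeFactors (· < B),
    Real.exp_add]
  push_cast
  refine mul_le_mul ?_ ?_ (by positivity) (Real.exp_pos _).le
  · calc ∏ p ∈ n.primeFactors with p < B, ((n.factorization p : ℝ) + 1)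
        ≤ ∏ p ∈ n.primeFactors with p < B, ((Nat.log 2 n : ℝ) + 1) := by
          refine Finset.prod_le_prod (fun p _ => by positivity) fun p hp => ?_
          rw [Finset.mem_filter] at hp
          have hpp := Nat.prime_of_mem_primeFactors hp.1
          have : n.factorization p ≤ Nat.log 2 n := by
            refine Nat.le_log_of_pow_le (by norm_num) ?_
            refine le_trans (Nat.pow_le_pow_left hpp.two_le _) ?_
            exact Nat.le_of_dvd hn (Nat.ordProj_dvd n p)
          have : (n.factorization p : ℝ) ≤ Nat.log 2 n := by exact_mod_cast this
          linarith
      _ = ((Nat.log 2 n : ℝ) + 1) ^ (n.primeFactors.filter (· < B)).card := by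
          rw [Finset.prod_const]
      _ ≤ ((Nat.log 2 n : ℝ) + 1) ^ B := by
          refine pow_le_pow_right₀ (by linarith [Nat.cast_nonneg (α := ℝ) (Nat.log 2 n)]) ?_
          calc _ ≤ (Finset.range B).card := Finset.card_le_card fun p hp =>
                Finset.mem_range.2 (Finset.mem_filter.1 hp).2
            _ = B := Finset.card_range B
      _ = _ := by
          rw [mul_comm, Real.exp_mul, Real.exp_log (by positivity), Real.rpow_natCast]
  · let V := ∑ p ∈ n.primeFactors with ¬ p < B, n.factorization p
    have h1 : ∏ p ∈ n.primeFactors with ¬ p < B, ((n.factorization p : ℝ) + 1) ≤ 2 ^ V := by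
      rw [← Finset.prod_pow_eq_pow_sum]
      refine Finset.prod_le_prod (fun p _ => by positivity) fun p _ => ?_
      have : n.factorization p + 1 ≤ 2 ^ n.factorization p := Nat.lt_two_pow_self
      exact_mod_cast this
    have h2 : B ^ V ≤ n := by
      calc B ^ V = ∏ p ∈ n.primeFactors with ¬ p < B, B ^ n.factorization p := by
            rw [Finset.prod_pow_eq_pow_sum]
        _ ≤ ∏ p ∈ n.primeFactors with ¬ p < B, p ^ n.factorization p :=
            Finset.prod_le_prod' fun p hp =>
              Nat.pow_le_pow_left (not_lt.1 (Finset.mem_filter.1 hp).2) _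
        _ ≤ ∏ p ∈ n.primeFactors, p ^ n.factorization p := by
            refine Finset.prod_le_prod_of_subset_of_one_le' (Finset.filter_subset _ _) ?_
            intro p hp _
            exact Nat.one_le_pow _ _ (Nat.prime_of_mem_primeFactors hp).pos
        _ = n := Nat.prod_factorization_pow_eq_self hn.ne'
    have h3 : (V : ℝ) ≤ Real.log n / Real.log B := by
      rw [le_div_iff₀ hlB, ← Real.log_pow]
      exact Real.log_le_log (by positivity) (by exact_mod_cast h2)
    refine h1.trans ?_
    rw [Real.exp_mul, Real.exp_log (by norm_num), ← Real.rpow_natCast]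
    exact Real.rpow_le_rpow_of_exponent_le (by norm_num) h3

/-- The divisor bound `τ(n) ≤ exp (O(log x / log₂ x))`, weakened to the form `L(x) ^ o(1)`. -/
theorem eventually_card_divisors_le {δ : ℝ} (hδ : 0 < δ) :
    ∀ᶠ x : ℝ in atTop, ∀ n : ℕ, 0 < n → (n : ℝ) ≤ x →
      (n.divisors.card : ℝ) ≤ Real.exp (δ * logRatio x * Real.log x) := by
  have e1 : ∀ᶠ ℓ : ℝ in atTop, 12 * ℓ ^ 2 ≤ δ / 2 * Real.exp (1 / 2 * ℓ) := by
    have := (isLittleO_pow_exp_pos_mul_atTop 2 (b := 1 / 2) (by norm_num)).bound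
      (show 0 < δ / 24 by positivity)
    filter_upwards [this] with ℓ h
    rw [Real.norm_of_nonneg (by positivity), Real.norm_of_nonneg (by positivity)] at h
    linarith
  filter_upwards [tendsto_log_log.eventually e1, tendsto_log_log.eventually_ge_atTop 4,
    (Real.tendsto_log_atTop.comp tendsto_log_log).eventually_ge_atTop (3 / δ),
    (Real.tendsto_log_atTop.comp tendsto_log_log).eventually_ge_atTop 1,
    Real.tendsto_log_atTop.eventually_gt_atTop 0] with x h1 h2 h3 h3' h4 n hn hnx
  simp only [Function.comp] at h3 h3'
  have hL : Real.exp (Real.log (Real.log x)) = Real.log x := Real.exp_log h4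
  set ℓ := Real.log (Real.log x) with hℓ
  let B := ⌈Real.exp (1 / 2 * ℓ)⌉₊
  have hE : 7 ≤ Real.exp (1 / 2 * ℓ) := by
    have h5 : Real.exp 2 ≤ Real.exp (1 / 2 * ℓ) := Real.exp_le_exp.2 (by linarith)
    have h6 : (2.7182818283 : ℝ) ^ 2 ≤ Real.exp 1 ^ 2 :=
      pow_le_pow_left₀ (by norm_num) Real.exp_one_gt_d9.le 2
    rw [← Real.exp_nat_mul] at h6
    norm_num at h6
    linarith
  have hB1 : Real.exp (1 / 2 * ℓ) ≤ B := Nat.le_ceil _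
  have hB2 : (B : ℝ) ≤ 2 * Real.exp (1 / 2 * ℓ) := by
    have := (Nat.ceil_lt_add_one (Real.exp_pos (1 / 2 * ℓ)).le).le
    have : (B : ℝ) ≤ Real.exp (1 / 2 * ℓ) + 1 := this
    linarith
  have hB : 2 ≤ B := by
    have : (2 : ℝ) ≤ B := by linarith
    exact_mod_cast this
  have hlB : 1 / 2 * ℓ ≤ Real.log B := by
    rw [← Real.log_exp (1 / 2 * ℓ)]
    exact Real.log_le_log (Real.exp_pos _) hB1
  refine (card_divisors_le_exp hB hn).trans (Real.exp_le_exp.2 ?_)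
  have hnR : (0 : ℝ) < n := by exact_mod_cast hn
  have hlogn : Real.log n ≤ Real.log x := Real.log_le_log hnR hnx
  have hlog0 : 0 ≤ Real.log n := Real.log_natCast_nonneg n
  have hsq : Real.exp (1 / 2 * ℓ) * Real.exp (1 / 2 * ℓ) = Real.log x := by
    rw [← Real.exp_add, ← hL]; congr 1; ring
  have hterm2 : Real.log 2 * (Real.log n / Real.log B) ≤ 2 * (Real.log x / ℓ) := by
    have h5 : Real.log n / Real.log B ≤ Real.log x / (1 / 2 * ℓ) :=
      div_le_div₀ h4.le hlogn (by linarith) hlB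
    have h6 : Real.log x / (1 / 2 * ℓ) = 2 * (Real.log x / ℓ) := by
      field_simp
    have h7 : Real.log 2 ≤ 1 := by have := Real.log_two_lt_d9; linarith
    calc Real.log 2 * (Real.log n / Real.log B) ≤ 1 * (Real.log n / Real.log B) :=
          mul_le_mul_of_nonneg_right h7 (div_nonneg hlog0 (by linarith))
      _ ≤ _ := by rw [one_mul, ← h6]; exact h5
  have hterm1 : Real.log ((Nat.log 2 n : ℝ) + 1) ≤ 2 * ℓ := by
    have h5 : (Nat.log 2 n : ℝ) ≤ 2 * Real.log x := by
      have h6 : (2 : ℝ) ^ Nat.log 2 n ≤ n := by exact_mod_cast Nat.pow_log_le_self 2 hn.ne'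
      have h7 := Real.log_le_log (by positivity) h6
      rw [Real.log_pow] at h7
      have h8 : (1 / 2 : ℝ) ≤ Real.log 2 := by have := Real.log_two_gt_d9; linarith
      nlinarith [Nat.cast_nonneg (α := ℝ) (Nat.log 2 n)]
    have h6 : (Nat.log 2 n : ℝ) + 1 ≤ Real.log x * Real.log x := by
      have : 49 ≤ Real.log x := by nlinarith
      nlinarith
    calc Real.log ((Nat.log 2 n : ℝ) + 1) ≤ Real.log (Real.log x * Real.log x) :=
          Real.log_le_log (by positivity) h6
      _ = 2 * ℓ := by rw [Real.log_mul h4.ne' h4.ne']; ring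
  have h9 : (B : ℝ) * Real.log ((Nat.log 2 n : ℝ) + 1) ≤ 4 * ℓ * Real.exp (1 / 2 * ℓ) := by
    have := mul_le_mul hB2 hterm1 (Real.log_nonneg (by
      linarith [Nat.cast_nonneg (α := ℝ) (Nat.log 2 n)])) (by positivity)
    linarith
  have hℓ0 : 0 < ℓ := by linarith
  have h10 : 4 * ℓ * Real.exp (1 / 2 * ℓ) ≤ δ / 3 * (Real.log x / ℓ) := by
    rw [mul_div_assoc', le_div_iff₀ hℓ0, ← hsq]
    have := mul_le_mul_of_nonneg_right h1 (Real.exp_pos (1 / 2 * ℓ)).le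
    nlinarith [Real.exp_pos (1 / 2 * ℓ)]
  have h11 : 3 ≤ δ * Real.log ℓ := by
    rw [div_le_iff₀ hδ] at h3; linarith
  have h12 : δ * logRatio x * Real.log x = δ * Real.log ℓ * (Real.log x / ℓ) := by
    rw [logRatio, ← hℓ]; ring
  rw [h12]
  have hX : 0 < Real.log x / ℓ := div_pos h4 hℓ0
  have h13 : δ * (Real.log x / ℓ) ≤ δ * Real.log ℓ * (Real.log x / ℓ) :=
    mul_le_mul_of_nonneg_right (by nlinarith) hX.le
  have h14 : 3 * (Real.log x / ℓ) ≤ δ * Real.log ℓ * (Real.log x / ℓ) :=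
    mul_le_mul_of_nonneg_right h11 hX.le
  linarith

theorem eventually_rankFiberCount_le {a₁ a₂ : ℤ} (hGP : GordonPomeranceConjecture a₁ a₂)
    {δ : ℝ} (hδ : 0 < δ) :
    ∀ᶠ t : ℝ in atTop, ∀ z : ℕ, 0 < z → (rankFiberCount a₁ a₂ z t : ℝ) ≤
      Real.exp (Real.log t * (1 - (1 - δ) * logRatio t)) := by
  obtain ⟨ε, hε, h⟩ := hGP
  filter_upwards [h, hε.eventually (lt_mem_nhds (show -δ < 0 by linarith)),
    eventually_logRatio_pos, eventually_gt_atTop 1] with t h1 h2 h3 h4 z hz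
  refine (h1 z hz).trans ?_
  have ht : 0 < t := by linarith
  have h5 : Lfun t = Real.exp (Real.log t * logRatio t) := by
    rw [Lfun, Real.rpow_def_of_pos ht, logRatio]
  rw [h5, ← Real.exp_mul]
  nth_rewrite 1 [← Real.exp_log ht]
  rw [← Real.exp_sub, Real.exp_le_exp]
  have h6 : 0 < Real.log t * logRatio t := mul_pos (Real.log_pos h4) h3
  nlinarith

/-- `logRatio` varies slowly: it is nearly constant between `x` and `x ^ 3`. -/
theorem eventually_logRatio_ge {δ : ℝ} (hδ : 0 < δ) :
    ∀ᶠ x : ℝ in atTop, ∀ X : ℝ, x ≤ X → Real.log X ≤ 3 * Real.log x →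
      (1 - δ) * logRatio x ≤ logRatio X := by
  filter_upwards [tendsto_log_log.eventually_ge_atTop 2,
    tendsto_log_log.eventually_ge_atTop (2 / δ), Real.tendsto_log_atTop.eventually_gt_atTop 0,
    eventually_gt_atTop 0] with x h1 h2 h3 h4 X hX hX'
  have h5 : Real.log x ≤ Real.log X := Real.log_le_log h4 hX
  have h6 : Real.log (Real.log x) ≤ Real.log (Real.log X) := Real.log_le_log h3 h5
  have h7 : Real.log (Real.log X) ≤ Real.log (Real.log x) + 2 := by
    calc Real.log (Real.log X) ≤ Real.log (3 * Real.log x) :=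
          Real.log_le_log (by linarith) hX'
      _ = Real.log 3 + Real.log (Real.log x) := Real.log_mul (by norm_num) h3.ne'
      _ ≤ _ := by
          have := Real.log_le_sub_one_of_pos (show (0 : ℝ) < 3 by norm_num)
          linarith
  rw [logRatio, logRatio]
  set ℓ := Real.log (Real.log x)
  set ℓ' := Real.log (Real.log X)
  have h8 : Real.log ℓ ≤ Real.log ℓ' := Real.log_le_log (by linarith) h6
  have h9 : 0 < Real.log ℓ := Real.log_pos (by linarith)
  have h10 : 2 ≤ δ * ℓ := by rw [div_le_iff₀ hδ] at h2; linarith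
  have h11 : (1 - δ) * (Real.log ℓ / ℓ) ≤ Real.log ℓ / (ℓ + 2) := by
    rw [mul_div_assoc', div_le_div_iff₀ (by linarith) (by linarith)]
    have : (1 - δ) * (ℓ + 2) ≤ ℓ := by nlinarith
    nlinarith
  exact h11.trans (div_le_div₀ (by linarith) h8 (by linarith) h7)

/-- The key use of the bound on the fibers of `z`. The products of `r` distinct primes of `P`,
where `2 ^ ((i + 1) * r)` is about `x`, all have their rank of appearance among the few divisors of
`G`; this bounds the binomial coefficient `#P.choose r`, hence `#P`. -/
theorem eventually_card_primes_le {a₁ a₂ : ℤ} (ha : IsUnit a₂)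
    (hGP : GordonPomeranceConjecture a₁ a₂) {δ : ℝ} (hδ : 0 < δ) (hδ1 : δ ≤ 1) :
    ∀ᶠ x : ℝ in atTop, ∀ i G : ℕ, 0 < i → (2 : ℝ) ^ i ≤ x → 0 < G → (G : ℝ) ≤ x →
      ∀ P : Finset ℕ, (∀ p ∈ P, p.Prime) → (∀ p ∈ P, p ≤ 2 ^ (i + 1)) →
        (∀ p ∈ P, (p : ℤ) ∣ lucasSeq a₁ a₂ G) →
        (P.card : ℝ) ≤ 4 * Real.log x *
          (2 : ℝ) ^ (((i : ℝ) + 1) * (1 - (1 - 3 * δ) * logRatio x)) := by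
  obtain ⟨T, hT⟩ := eventually_atTop.1 (eventually_rankFiberCount_le hGP hδ)
  filter_upwards [eventually_ge_atTop T, eventually_card_divisors_le hδ,
    eventually_logRatio_ge hδ, eventually_logRatio_pos,
    tendsto_logRatio.eventually (gt_mem_nhds (show (0 : ℝ) < (1 + 3 * δ)⁻¹ by positivity)),
    Real.tendsto_log_atTop.eventually_ge_atTop 1, eventually_ge_atTop 2] with
    x hxT hdiv hrat hκ0 hκ1 hL hx2 i G hi hix hG hGx P hP hPi hPG
  set κ := logRatio x with hκ
  set L := Real.log x with hLdef
  let b : ℕ := 2 ^ (i + 1)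
  have hbR : (b : ℝ) = (2 : ℝ) ^ (i + 1) := by simp [b]
  have hlb : Real.log b = ((i : ℝ) + 1) * Real.log 2 := by
    rw [hbR, Real.log_pow]; push_cast; ring
  have hl2 := Real.log_two_gt_d9
  have hl2' := Real.log_two_lt_d9
  have hi1 : (1 : ℝ) ≤ i := by exact_mod_cast hi
  have hlb1 : 1 ≤ Real.log b := by rw [hlb]; nlinarith
  have hlbL : Real.log b ≤ 2 * L := by
    have h1 := Real.log_le_log (by positivity) hix
    rw [Real.log_pow] at h1
    rw [hlb]
    linarith
  let r := ⌈L / Real.log b⌉₊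
  have hr1 : L / Real.log b ≤ r := Nat.le_ceil _
  have hr2 : (r : ℝ) < L / Real.log b + 1 := Nat.ceil_lt_add_one (by positivity)
  have hr0 : 0 < r := Nat.ceil_pos.2 (by positivity)
  have hrR : (0 : ℝ) < r := by exact_mod_cast hr0
  have hrL : (r : ℝ) ≤ 2 * L := by
    have : L / Real.log b ≤ L := div_le_self (by linarith) hlb1
    linarith
  have hlogX : Real.log ((b ^ r : ℕ) : ℝ) = r * Real.log b := by
    push_cast; rw [Real.log_pow]
  have hX1 : L ≤ r * Real.log b := by
    rwa [div_le_iff₀ (by linarith)] at hr1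
  have hX2 : r * Real.log b ≤ 3 * L := by
    have : (r : ℝ) * Real.log b ≤ (L / Real.log b + 1) * Real.log b :=
      mul_le_mul_of_nonneg_right hr2.le (by linarith)
    rw [add_mul, div_mul_cancel₀ _ (by linarith)] at this
    linarith
  have hb0 : (0 : ℝ) < b := by rw [hbR]; positivity
  have hxX : x ≤ ((b ^ r : ℕ) : ℝ) := by
    rw [← Real.log_le_log_iff (by linarith) (by push_cast; positivity), hlogX]; exact hX1
  have hratX : (1 - δ) * κ ≤ logRatio ((b ^ r : ℕ) : ℝ) := hrat _ hxX (by rw [hlogX]; exact hX2)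
  let Q : ℝ := (2 : ℝ) ^ (((i : ℝ) + 1) * (1 - (1 - 3 * δ) * κ))
  have hQ : Q = Real.exp (Real.log b * (1 - (1 - 3 * δ) * κ)) := by
    simp only [Q]
    rw [Real.rpow_def_of_pos (by norm_num), hlb]; congr 1; ring
  have hexp0 : 0 ≤ 1 - (1 - 3 * δ) * κ := by
    have h1 : κ * (1 + 3 * δ) < 1 := by
      rwa [← one_div, lt_div_iff₀ (by positivity)] at hκ1
    nlinarith
  have hQ1 : 1 ≤ Q := by
    rw [hQ]; exact Real.one_le_exp (mul_nonneg (by linarith) hexp0)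
  change (P.card : ℝ) ≤ 4 * L * Q
  have hchoose : ((P.card.choose r : ℕ) : ℝ) ≤ Q ^ r := by
    refine (choose_card_le ha hP (y := b) (r := r) hG hPi hPG
      (hT ((b ^ r : ℕ) : ℝ) (hxT.trans hxX))).trans ?_
    rw [hQ, ← Real.exp_nat_mul]
    refine (mul_le_mul_of_nonneg_right (hdiv G hG hGx) (Real.exp_pos _).le).trans ?_
    rw [← Real.exp_add, Real.exp_le_exp, hlogX, ← mul_assoc]
    set lX := (r : ℝ) * Real.log b
    have hlX0 : 0 ≤ lX := by linarith
    have h1 : (1 - δ) * ((1 - δ) * κ) ≤ (1 - δ) * logRatio ((b ^ r : ℕ) : ℝ) :=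
      mul_le_mul_of_nonneg_left hratX (by linarith)
    have h2 : δ * κ * L ≤ δ * κ * lX := mul_le_mul_of_nonneg_left hX1 (by positivity)
    have h3 := mul_le_mul_of_nonneg_left h1 hlX0
    have h4 : 0 ≤ lX * (δ ^ 2 * κ) := by positivity
    nlinarith
  rcases lt_or_ge P.card r with hlt | hge
  · have h1 : (P.card : ℝ) ≤ r := by exact_mod_cast hlt.le
    nlinarith
  · have h1 := Nat.pow_le_choose (α := ℝ) r P.card
    rw [div_le_iff₀ (by positivity)] at h1
    have h2 : ((P.card + 1 - r : ℕ) : ℝ) ^ r ≤ (r * Q) ^ r := by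
      have h3 : ((r.factorial : ℕ) : ℝ) ≤ (r : ℝ) ^ r := by exact_mod_cast Nat.factorial_le_pow r
      calc ((P.card + 1 - r : ℕ) : ℝ) ^ r ≤ (P.card.choose r : ℕ) * (r.factorial : ℕ) := by
            exact_mod_cast h1
        _ ≤ Q ^ r * (r : ℝ) ^ r := mul_le_mul hchoose h3 (by positivity) (by positivity)
        _ = _ := by rw [mul_pow]; ring
    have h4 := le_of_pow_le_pow_left₀ hr0.ne' (by positivity) h2
    have h5 : ((P.card + 1 - r : ℕ) : ℝ) = P.card + 1 - r := by
      rw [Nat.cast_sub (by omega)]; push_cast; ring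
    rw [h5] at h4
    have h6 : (r : ℝ) * Q ≤ 2 * L * Q := mul_le_mul_of_nonneg_right hrL (by linarith)
    have h7 : (2 * L) * 1 ≤ 2 * L * Q := mul_le_mul_of_nonneg_left hQ1 (by linarith)
    linarith

/-! ### The upper bound -/

theorem sum_ite_geometric_le {A D q : ℝ} (hA : 0 ≤ A) (hD : 0 ≤ D) (hq0 : 0 ≤ q) (hq1 : q < 1)
    (j I : ℕ) :
    ∑ i ∈ Finset.range I, (if i < j then A else D * q ^ i) ≤ j * A + D * (q ^ j / (1 - q)) := by
  have h0 : ∀ i : ℕ, 0 ≤ (if i < j then A else D * q ^ i) := fun i => by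
    split_ifs <;> positivity
  have h1 : ∑ i ∈ Finset.range I, (if i < j then A else D * q ^ i) ≤
      ∑ i ∈ Finset.range (j + I), (if i < j then A else D * q ^ i) :=
    Finset.sum_le_sum_of_subset_of_nonneg (Finset.range_subset_range.2 (by omega))
      fun i _ _ => h0 i
  refine h1.trans ?_
  rw [Finset.sum_range_add]
  refine add_le_add ?_ ?_
  · rw [Finset.sum_congr rfl fun i hi => if_pos (Finset.mem_range.1 hi)]
    simp
  · calc ∑ k ∈ Finset.range I, (if j + k < j then A else D * q ^ (j + k))
        = D * (q ^ j * ∑ k ∈ Finset.range I, q ^ k) := by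
          rw [Finset.mul_sum, Finset.mul_sum]
          refine Finset.sum_congr rfl fun k _ => ?_
          rw [if_neg (by omega), pow_add]
      _ ≤ _ := by
          refine mul_le_mul_of_nonneg_left ?_ hD
          rw [div_eq_mul_inv]
          refine mul_le_mul_of_nonneg_left ?_ (by positivity)
          exact sum_le_hasSum _ (fun k _ => by positivity) (hasSum_geometric_of_lt_one hq0 hq1)

theorem sum_rpow_neg_le_card {c : ℝ} (hc : 0 ≤ c) {i : ℕ} {P : Finset ℕ}
    (hP : ∀ p ∈ P, 2 ^ i ≤ p) :
    ∑ p ∈ P, (p : ℝ) ^ (-c) ≤ P.card * (2 : ℝ) ^ (-(i * c)) := by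
  rw [← nsmul_eq_mul, ← Finset.sum_const]
  refine Finset.sum_le_sum fun p hp => ?_
  have h1 : (2 : ℝ) ^ i ≤ p := by exact_mod_cast hP p hp
  calc (p : ℝ) ^ (-c) ≤ ((2 : ℝ) ^ i) ^ (-c) :=
        Real.rpow_le_rpow_of_nonpos (by positivity) h1 (by linarith)
    _ = _ := by
        rw [← Real.rpow_natCast, ← Real.rpow_mul (by norm_num)]; congr 1; ring

theorem half_le_one_sub_exp_neg {u : ℝ} (h0 : 0 ≤ u) (h1 : u ≤ 1) :
    u / 2 ≤ 1 - Real.exp (-u) := by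
  have ha : Real.exp (-u) ≤ 1 / (1 + u) := by
    rw [Real.exp_neg, ← one_div]
    exact one_div_le_one_div_of_le (by linarith) (by linarith [Real.add_one_le_exp u])
  have hb : 1 / (1 + u) ≤ 1 - u / 2 := by
    rw [div_le_iff₀ (by linarith)]
    linarith [mul_nonneg h0 (sub_nonneg.2 h1)]
  linarith

theorem eventually_mul_pow_le_exp {ε : ℝ} (hε : 0 < ε) :
    ∀ᶠ ℓ : ℝ in atTop, 8 * ℓ ^ 3 ≤ ε * Real.exp (1 / 2 * ℓ) := by
  have := (isLittleO_pow_exp_pos_mul_atTop 3 (b := 1 / 2) (by norm_num)).bound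
    (show 0 < ε / 8 by positivity)
  filter_upwards [this, eventually_gt_atTop 0] with ℓ h h0
  rw [Real.norm_of_nonneg (by positivity), Real.norm_of_nonneg (by positivity)] at h
  linarith

/-- The blocks of small primes, of size at most `2 ^ j = exp (O(ℓ ^ (3 / 2)))` with
`ℓ = log₂ x`, contribute little. -/
theorem eventually_small_blocks_le {ε : ℝ} (hε : 0 < ε) :
    ∀ᶠ ℓ : ℝ in atTop, 4 * (⌈ℓ * √ℓ⌉₊ * (2 : ℝ) ^ (⌈ℓ * √ℓ⌉₊ * (Real.log ℓ / ℓ))) ≤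
      ε * (Real.log ℓ / ℓ) * Real.exp ℓ := by
  have e2 : ∀ᶠ ℓ : ℝ in atTop, 4 * Real.log ℓ ≤ √ℓ := by
    have := (isLittleO_log_rpow_atTop (r := 1 / 2) (by norm_num)).bound
      (show (0 : ℝ) < 1 / 4 by norm_num)
    filter_upwards [this, eventually_gt_atTop 1] with ℓ h h0
    rw [Real.norm_of_nonneg (Real.log_nonneg h0.le), Real.norm_of_nonneg (by positivity),
      ← Real.sqrt_eq_rpow] at h
    linarith
  filter_upwards [eventually_mul_pow_le_exp hε, e2, eventually_ge_atTop 4,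
    Real.tendsto_log_atTop.eventually_ge_atTop 1] with ℓ h1 h2 h5 h7
  set κ := Real.log ℓ / ℓ with hκ
  set j := ⌈ℓ * √ℓ⌉₊ with hj
  have hℓ0 : 0 < ℓ := by linarith
  have hκ0 : 0 < κ := div_pos (by linarith) hℓ0
  have hκℓ : κ * ℓ = Real.log ℓ := div_mul_cancel₀ _ hℓ0.ne'
  have hsq : √ℓ * √ℓ = ℓ := Real.mul_self_sqrt hℓ0.le
  have hsq2 : 2 ≤ √ℓ := Real.le_sqrt_of_sq_le (by linarith)
  have hju : (j : ℝ) ≤ 2 * (ℓ * √ℓ) := by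
    have := (Nat.ceil_lt_add_one (show 0 ≤ ℓ * √ℓ by positivity)).le
    rw [← hj] at this
    have : 4 * 2 ≤ ℓ * √ℓ := mul_le_mul h5 hsq2 (by norm_num) hℓ0.le
    linarith
  have hjκu : (j : ℝ) * κ ≤ 2 * (√ℓ * Real.log ℓ) := by
    calc (j : ℝ) * κ ≤ 2 * (ℓ * √ℓ) * κ := mul_le_mul_of_nonneg_right hju hκ0.le
      _ = _ := by rw [← hκℓ]; ring
  have hl2' := Real.log_two_lt_d9
  have hE := Real.exp_pos (1 / 2 * ℓ)
  have ha : (2 : ℝ) ^ (j * κ) ≤ Real.exp (1 / 2 * ℓ) := by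
    rw [Real.rpow_def_of_pos (by norm_num), Real.exp_le_exp]
    have hc : √ℓ * (4 * Real.log ℓ) ≤ √ℓ * √ℓ :=
      mul_le_mul_of_nonneg_left h2 (Real.sqrt_nonneg _)
    have hd : Real.log 2 * ((j : ℝ) * κ) ≤ 1 * ((j : ℝ) * κ) :=
      mul_le_mul_of_nonneg_right (by linarith) (by positivity)
    linarith
  have hb : (j : ℝ) ≤ 2 * ℓ ^ 2 := by
    have h8 : √ℓ ≤ ℓ := by
      calc √ℓ = √ℓ * 1 := (mul_one _).symm
        _ ≤ √ℓ * √ℓ := mul_le_mul_of_nonneg_left (by linarith) (Real.sqrt_nonneg _)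
        _ = ℓ := hsq
    have := mul_le_mul_of_nonneg_left h8 hℓ0.le
    rw [sq]; linarith
  have hd : 8 * ℓ ^ 2 ≤ ε * κ * Real.exp (1 / 2 * ℓ) := by
    have h8 : 8 * ℓ ^ 2 * ℓ ≤ ε * κ * Real.exp (1 / 2 * ℓ) * ℓ := by
      have : ε * κ * Real.exp (1 / 2 * ℓ) * ℓ = Real.log ℓ * (ε * Real.exp (1 / 2 * ℓ)) := by
        rw [← hκℓ]; ring
      rw [this]
      have := mul_le_mul_of_nonneg_right h7 (show 0 ≤ ε * Real.exp (1 / 2 * ℓ) by positivity)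
      linarith
    exact le_of_mul_le_mul_right h8 hℓ0
  calc 4 * (j * (2 : ℝ) ^ (j * κ)) ≤ 4 * (2 * ℓ ^ 2 * Real.exp (1 / 2 * ℓ)) :=
        mul_le_mul_of_nonneg_left (mul_le_mul hb ha (by positivity) (by positivity)) (by norm_num)
    _ = 8 * ℓ ^ 2 * Real.exp (1 / 2 * ℓ) := by ring
    _ ≤ ε * κ * Real.exp (1 / 2 * ℓ) * Real.exp (1 / 2 * ℓ) :=
        mul_le_mul_of_nonneg_right hd hE.le
    _ = ε * κ * Real.exp ℓ := by
        rw [mul_assoc, ← Real.exp_add]; congr 2; ring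

/-- The cut-off `exp (ℓ ^ (3 / 2))` is large enough for the geometric series over the blocks of
large primes to beat the factor `log x` lost in each of them. -/
theorem eventually_large_blocks_le {ε : ℝ} (hε : 0 < ε) :
    ∀ᶠ ℓ : ℝ in atTop, 32 * (((2 : ℝ) ^ (-(ε * (Real.log ℓ / ℓ)))) ^ ⌈ℓ * √ℓ⌉₊ /
      (1 - (2 : ℝ) ^ (-(ε * (Real.log ℓ / ℓ))))) ≤ ε * (Real.log ℓ / ℓ) := by
  have e3 : ∀ᶠ ℓ : ℝ in atTop, 6 / ε ≤ √ℓ :=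
    Real.tendsto_sqrt_atTop.eventually_ge_atTop _
  have e4 : ∀ᶠ ℓ : ℝ in atTop, Real.log ℓ / ℓ < 1 / ε :=
    tendsto_log_div_self.eventually (gt_mem_nhds (by positivity))
  filter_upwards [e3, e4, eventually_ge_atTop 4, eventually_ge_atTop (128 / ε ^ 2),
    Real.tendsto_log_atTop.eventually_ge_atTop 1] with ℓ h3 h4 h5 h6 h7
  set κ := Real.log ℓ / ℓ with hκ
  set j := ⌈ℓ * √ℓ⌉₊ with hj
  have hℓ0 : 0 < ℓ := by linarith
  have hκ0 : 0 < κ := div_pos (by linarith) hℓ0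
  have hκℓ : κ * ℓ = Real.log ℓ := div_mul_cancel₀ _ hℓ0.ne'
  have hκ1 : 1 / ℓ ≤ κ := div_le_div_of_nonneg_right h7 hℓ0.le
  have hjκl : √ℓ * Real.log ℓ ≤ j * κ := by
    calc √ℓ * Real.log ℓ = ℓ * √ℓ * κ := by rw [← hκℓ]; ring
      _ ≤ _ := mul_le_mul_of_nonneg_right (Nat.le_ceil _) hκ0.le
  have hεκ0 : 0 < ε * κ := mul_pos hε hκ0
  have hl2 := Real.log_two_gt_d9
  have hl2' := Real.log_two_lt_d9
  set u := ε * κ * Real.log 2 with hu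
  have hu0 : 0 < u := by positivity
  have hεκ : ε * κ ≤ 1 := by
    rw [lt_div_iff₀ hε] at h4
    linarith
  have hu1 : u ≤ 1 := mul_le_one₀ hεκ (by linarith) (by linarith)
  have hq : (2 : ℝ) ^ (-(ε * κ)) = Real.exp (-u) := by
    rw [Real.rpow_def_of_pos (by norm_num)]; congr 1; rw [hu]; ring
  have hq1 : ε * κ / 4 ≤ 1 - Real.exp (-u) := by
    have hb := half_le_one_sub_exp_neg hu0.le hu1
    have hc : ε * κ * (1 / 2) ≤ u := mul_le_mul_of_nonneg_left (by linarith) hεκ0.le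
    linarith
  have hqj : Real.exp (-u) ^ j ≤ (ε * κ) ^ 2 / 128 := by
    have hεs : 3 ≤ ε / 2 * √ℓ := by
      rw [div_le_iff₀ hε] at h3; linarith
    calc Real.exp (-u) ^ j = Real.exp (-(j * u)) := by
          rw [← Real.exp_nat_mul]; congr 1; ring
      _ ≤ Real.exp (-(3 * Real.log ℓ)) := by
          rw [Real.exp_le_exp, neg_le_neg_iff, hu]
          have ha : (j : ℝ) * (ε * κ * Real.log 2) = (ε * Real.log 2) * (j * κ) := by ring
          rw [ha]
          have hε2 : ε / 2 ≤ ε * Real.log 2 := by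
            rw [div_eq_mul_inv]; exact mul_le_mul_of_nonneg_left (by linarith) hε.le
          have hb : ε / 2 * (√ℓ * Real.log ℓ) ≤ (ε * Real.log 2) * (j * κ) :=
            mul_le_mul hε2 hjκl (by positivity) (by positivity)
          have hc : 3 * Real.log ℓ ≤ ε / 2 * √ℓ * Real.log ℓ :=
            mul_le_mul_of_nonneg_right hεs (by linarith)
          linarith
      _ = 1 / ℓ ^ 3 := by
          rw [Real.exp_neg, one_div]; congr 1
          rw [show (3 : ℝ) * Real.log ℓ = Real.log (ℓ ^ 3) by rw [Real.log_pow]; norm_num,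
            Real.exp_log (by positivity)]
      _ ≤ (ε / ℓ) ^ 2 / 128 := by
          rw [div_le_iff₀ (by positivity)] at h6
          rw [div_pow, div_div, div_le_div_iff₀ (by positivity) (by positivity)]
          have := mul_le_mul_of_nonneg_right h6 (pow_pos hℓ0 2).le
          linarith
      _ ≤ _ := by
          have : ε / ℓ ≤ ε * κ := by
            rw [div_eq_mul_one_div]; exact mul_le_mul_of_nonneg_left hκ1 hε.le
          have := pow_le_pow_left₀ (by positivity) this 2
          linarith
  rw [hq]
  have h8 : Real.exp (-u) ^ j / (1 - Real.exp (-u)) ≤ ((ε * κ) ^ 2 / 128) / (ε * κ / 4) :=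
    div_le_div₀ (by positivity) hqj (by positivity) hq1
  have h9 : ((ε * κ) ^ 2 / 128) / (ε * κ / 4) = ε * κ / 32 := by
    field_simp; norm_num
  linarith

theorem eventually_one_add_exp_le {ε : ℝ} (hε : 0 < ε) :
    ∀ᶠ ℓ : ℝ in atTop,
      1 + Real.exp ℓ ≤ Real.exp (ε * (Real.log ℓ / ℓ) * Real.exp ℓ) := by
  filter_upwards [eventually_mul_pow_le_exp hε, eventually_ge_atTop 4,
    Real.tendsto_log_atTop.eventually_ge_atTop 1] with ℓ h1 h5 h7
  have hℓ0 : 0 < ℓ := by linarith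
  have ha : ℓ + 1 ≤ ε * (Real.log ℓ / ℓ) * Real.exp ℓ := by
    have hb : 8 * ℓ ^ 3 ≤ ε * Real.exp ℓ :=
      h1.trans (mul_le_mul_of_nonneg_left (Real.exp_le_exp.2 (by linarith)) hε.le)
    have hc : ε * Real.exp ℓ ≤ Real.log ℓ * (ε * Real.exp ℓ) :=
      le_mul_of_one_le_left (by positivity) h7
    have hd : ε * (Real.log ℓ / ℓ) * Real.exp ℓ = Real.log ℓ * (ε * Real.exp ℓ) / ℓ := by ring
    rw [hd, le_div_iff₀ hℓ0]
    nlinarith [mul_pos hℓ0 hℓ0]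
  calc 1 + Real.exp ℓ ≤ 2 * Real.exp ℓ := by linarith [Real.one_le_exp hℓ0.le]
    _ ≤ Real.exp 1 * Real.exp ℓ :=
        mul_le_mul_of_nonneg_right (by linarith [Real.exp_one_gt_d9]) (Real.exp_pos ℓ).le
    _ = Real.exp (ℓ + 1) := by rw [← Real.exp_add, add_comm]
    _ ≤ _ := Real.exp_le_exp.2 ha

/-- The upper half of the asymptotic formula. -/
theorem eventually_sum_gcd_pow_le {a₁ a₂ : ℤ} (ha : IsUnit a₂) (hD : lucasDisc a₁ a₂ ≠ 0)
    (hGP : GordonPomeranceConjecture a₁ a₂) {l : ℕ} (hl : 0 < l) {ε : ℝ} (hε : 0 < ε)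
    (hε1 : ε ≤ 1 / 8) :
    ∀ᶠ x : ℝ in atTop,
      ∑ n ∈ Finset.Icc 1 ⌊x⌋₊, (Int.gcd (n : ℤ) (lucasSeq a₁ a₂ n) : ℝ) ^ l ≤
        x ^ ((l : ℝ) + 1 - (1 - 7 * ε) * logRatio x) := by
  filter_upwards [eventually_card_primes_le ha hGP hε (by linarith),
    tendsto_log_log.eventually (eventually_small_blocks_le hε),
    tendsto_log_log.eventually (eventually_large_blocks_le hε),
    tendsto_log_log.eventually (eventually_one_add_exp_le hε), eventually_logRatio_pos,
    tendsto_logRatio.eventually (gt_mem_nhds (show (0 : ℝ) < 1 / 2 by norm_num)),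
    tendsto_log_log.eventually_ge_atTop 4,
    tendsto_log_log.eventually_ge_atTop ((lucasDisc a₁ a₂).natAbs : ℝ),
    Real.tendsto_log_atTop.eventually_ge_atTop 1, eventually_ge_atTop 2] with
    x hcard hb1 hb1' hb2 hκ0 hκ1 hℓ4 hℓD hL hx
  set ℓ := Real.log (Real.log x) with hℓ
  have hexp : Real.exp ℓ = Real.log x := Real.exp_log (by linarith)
  have hκ : Real.log ℓ / ℓ = logRatio x := rfl
  rw [hκ] at hb1'
  rw [hκ, hexp] at hb1 hb2
  set κ := logRatio x
  set L := Real.log x with hLdef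
  set j := ⌈ℓ * √ℓ⌉₊ with hj
  set N := ⌊x⌋₊ with hN
  have hx0 : 0 < x := by linarith
  have hNx : (N : ℝ) ≤ x := Nat.floor_le hx0.le
  have hN1 : 1 ≤ N := Nat.le_floor (by norm_num; linarith)
  have hsq2 : 2 ≤ √ℓ := Real.le_sqrt_of_sq_le (by linarith)
  have hjℓ : ℓ ≤ j := le_trans (by nlinarith) (Nat.le_ceil (ℓ * √ℓ))
  have hj2 : 2 ≤ j := by
    have : (2 : ℝ) ≤ j := by linarith
    exact_mod_cast this
  have hjD : (lucasDisc a₁ a₂).natAbs < 2 ^ j := by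
    have h1 : ((lucasDisc a₁ a₂).natAbs : ℝ) ≤ j := hℓD.trans hjℓ
    have h2 : (lucasDisc a₁ a₂).natAbs ≤ j := by exact_mod_cast h1
    exact lt_of_le_of_lt h2 Nat.lt_two_pow_self
  set c := 1 - (1 - 4 * ε) * κ with hc
  have hc2 : 1 / 2 ≤ c := by rw [hc]; nlinarith
  set q : ℝ := (2 : ℝ) ^ (-(ε * κ)) with hq
  have hq0 : 0 < q := Real.rpow_pos_of_pos (by norm_num) _
  have hq1 : q < 1 := Real.rpow_lt_one_of_one_lt_of_neg (by norm_num) (by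
    have := mul_pos hε hκ0; linarith)
  have hsum : ∀ m ∈ Finset.Icc 1 N,
      ∑ n ∈ lucasLayer a₁ a₂ m j (N / m) (Nat.log 2 N + 1), (n : ℝ) ^ (-c) ≤
        Real.exp (2 * ε * κ * L) := by
    intro m hm
    rw [Finset.mem_Icc] at hm
    refine (sum_lucasLayer_le ha hD hj2 hjD hc2
      (s := fun i => if i < j then (2 : ℝ) ^ (j * κ) else 8 * L * q ^ i) _ ?_).trans ?_
    · intro i hi t ht
      have hi2 : 2 ^ i ≤ N :=
        (Nat.le_log_iff_pow_le (by norm_num) (by omega)).1 (Nat.lt_succ_iff.1 hi)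
      have hblk : ∀ p ∈ lucasBlock a₁ a₂ j i (t * m), (2 ^ i ≤ p ∧ p < 2 ^ (i + 1)) ∧ p.Prime ∧
          (j ≤ i → (p : ℤ) ∣ lucasSeq a₁ a₂ (t * m)) := by
        intro p hp
        classical
        rw [lucasBlock, Finset.mem_filter, Finset.mem_Ico] at hp
        exact hp
      refine (sum_rpow_neg_le_card (c := c) (by linarith) (i := i)
        fun p hp => (hblk p hp).1.1).trans ?_
      split_ifs with hij
      · have h1 : ((lucasBlock a₁ a₂ j i (t * m)).card : ℝ) ≤ (2 : ℝ) ^ (i : ℝ) := by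
          have h2 : (lucasBlock a₁ a₂ j i (t * m)).card ≤ 2 ^ i := by
            refine (Finset.card_le_card (Finset.filter_subset _ _)).trans ?_
            rw [Nat.card_Ico, pow_succ]; omega
          rw [Real.rpow_natCast]
          exact_mod_cast h2
        refine (mul_le_mul_of_nonneg_right h1 (by positivity)).trans ?_
        rw [← Real.rpow_add (by norm_num)]
        refine Real.rpow_le_rpow_of_exponent_le (by norm_num) ?_
        have h3 : (i : ℝ) ≤ j := by exact_mod_cast hij.le
        have h4 : (i : ℝ) + -(i * c) = i * ((1 - 4 * ε) * κ) := by rw [hc]; ring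
        rw [h4]
        have h5 : (1 - 4 * ε) * κ ≤ κ := by nlinarith [mul_pos hε hκ0]
        exact mul_le_mul h3 h5 (by nlinarith) (by positivity)
      · have ht' : 1 ≤ t ∧ t ≤ N / m := by
          classical
          exact Finset.mem_Icc.1 (Finset.mem_filter.1 ht).1
        have htm : t * m ≤ N := (Nat.le_div_iff_mul_le (by omega)).1 ht'.2
        have htm0 : 0 < t * m := Nat.mul_pos (by omega) (by omega)
        have h1 := hcard i (t * m) (by omega)
          (le_trans (by exact_mod_cast hi2) hNx) htm0 (le_trans (by exact_mod_cast htm) hNx)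
          (lucasBlock a₁ a₂ j i (t * m)) (fun p hp => (hblk p hp).2.1)
          (fun p hp => (hblk p hp).1.2.le) (fun p hp => (hblk p hp).2.2 (by omega))
        refine (mul_le_mul_of_nonneg_right h1 (by positivity)).trans ?_
        rw [mul_assoc, ← Real.rpow_add (by norm_num)]
        have h2 : (2 : ℝ) ^ (((i : ℝ) + 1) * (1 - (1 - 3 * ε) * κ) + -(i * c)) ≤
            2 * q ^ i := by
          rw [hq, ← Real.rpow_natCast, ← Real.rpow_mul (by norm_num)]
          nth_rewrite 2 [← Real.rpow_one 2]
          rw [← Real.rpow_add (by norm_num)]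
          refine Real.rpow_le_rpow_of_exponent_le (by norm_num) ?_
          have : 0 ≤ (1 - 3 * ε) * κ := mul_nonneg (by linarith) hκ0.le
          rw [hc]
          linarith
        have := mul_le_mul_of_nonneg_left h2 (show 0 ≤ 4 * L by linarith)
        linarith
    · rw [Real.exp_le_exp]
      have h1 := sum_ite_geometric_le (A := (2 : ℝ) ^ (j * κ)) (D := 8 * L) (q := q)
        (by positivity) (by linarith) hq0.le hq1 j (Nat.log 2 N + 1)
      have h2 := mul_le_mul_of_nonneg_right hb1' (show 0 ≤ L by linarith)
      linarith
  refine (sum_gcd_pow_le hl (Nat.lt_pow_succ_log_self (by norm_num) N) (by linarith)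
    (Real.exp_pos _).le hsum).trans ?_
  have hlogN : 1 + Real.log N ≤ Real.exp (ε * κ * L) := by
    have : Real.log N ≤ L := Real.log_le_log (by exact_mod_cast hN1) hNx
    linarith
  have hpow : (N : ℝ) ^ ((l : ℝ) + c) ≤ x ^ ((l : ℝ) + c) :=
    Real.rpow_le_rpow (by positivity) hNx (by positivity)
  have hlogN0 : 0 ≤ 1 + Real.log N := by
    linarith [Real.log_natCast_nonneg N]
  calc (N : ℝ) ^ ((l : ℝ) + c) * Real.exp (2 * ε * κ * L) * (1 + Real.log N)
      ≤ x ^ ((l : ℝ) + c) * Real.exp (2 * ε * κ * L) * Real.exp (ε * κ * L) :=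
        mul_le_mul (mul_le_mul_of_nonneg_right hpow (Real.exp_pos _).le) hlogN hlogN0
          (by positivity)
    _ = x ^ ((l : ℝ) + 1 - (1 - 7 * ε) * κ) := by
        rw [Real.rpow_def_of_pos hx0, Real.rpow_def_of_pos hx0, ← Real.exp_add, ← Real.exp_add]
        congr 1
        rw [hc]
        ring

/-! ### A lower bound for smooth numbers -/

open ArithmeticFunction in
theorem sum_log_eq_sum_vonMangoldt (N : ℕ) :
    ∑ n ∈ Finset.Ioc 0 N, Real.log n = ∑ d ∈ Finset.Ioc 0 N, vonMangoldt d * (N / d : ℕ) := by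
  rw [← sum_Ioc_mul_zeta_eq_sum, vonMangoldt_mul_zeta]
  rfl

theorem sum_log_eq_log_factorial (N : ℕ) :
    ∑ n ∈ Finset.Ioc 0 N, Real.log n = Real.log (N.factorial : ℕ) := by
  induction N with
  | zero => simp
  | succ N ih =>
    rw [Finset.sum_Ioc_succ_top (Nat.zero_le N), ih, Nat.factorial_succ]
    push_cast
    rw [Real.log_mul (by positivity) (by positivity)]
    ring

open ArithmeticFunction in
/-- Lower bound in Mertens' first theorem. -/
theorem log_sub_one_le_sum_vonMangoldt_div {N : ℕ} (hN : 0 < N) :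
    Real.log N - 1 ≤ ∑ d ∈ Finset.Ioc 0 N, vonMangoldt d / d := by
  have hN0 : (0 : ℝ) < N := by exact_mod_cast hN
  have h1 := Real.pow_div_factorial_le_exp (x := N) hN0.le N
  have h2 := Real.log_le_log (by positivity) h1
  rw [Real.log_exp, Real.log_div (by positivity) (by positivity), Real.log_pow] at h2
  have h3 : Real.log (N.factorial : ℕ) ≤ N * ∑ d ∈ Finset.Ioc 0 N, vonMangoldt d / d := by
    rw [← sum_log_eq_log_factorial, sum_log_eq_sum_vonMangoldt, Finset.mul_sum]
    refine Finset.sum_le_sum fun d _ => ?_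
    rw [mul_div_left_comm]
    exact mul_le_mul_of_nonneg_left Nat.cast_div_le vonMangoldt_nonneg
  refine le_of_mul_le_mul_left (a := (N : ℝ)) ?_ hN0
  linarith

open ArithmeticFunction in
/-- Upper bound in Mertens' first theorem. -/
theorem sum_vonMangoldt_div_le (N : ℕ) :
    ∑ d ∈ Finset.Ioc 0 N, vonMangoldt d / d ≤ Real.log N + (Real.log 4 + 4) := by
  rcases Nat.eq_zero_or_pos N with rfl | hN
  · simp only [Finset.Ioc_self, Finset.sum_empty, CharP.cast_eq_zero, Real.log_zero]
    positivity
  have hN0 : (0 : ℝ) < N := by exact_mod_cast hN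
  have h1 : Real.log (N.factorial : ℕ) ≤ N * Real.log N := by
    rw [← Real.log_pow]
    exact Real.log_le_log (by positivity) (by exact_mod_cast Nat.factorial_le_pow N)
  have h2 := Chebyshev.psi_le_const_mul_self hN0.le
  have h3 : N * ∑ d ∈ Finset.Ioc 0 N, vonMangoldt d / d ≤
      Real.log (N.factorial : ℕ) + Chebyshev.psi N := by
    rw [← sum_log_eq_log_factorial, sum_log_eq_sum_vonMangoldt, Finset.mul_sum, Chebyshev.psi,
      Nat.floor_natCast, ← Finset.sum_add_distrib]
    refine Finset.sum_le_sum fun d hd => ?_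
    rw [mul_div_left_comm, ← mul_add_one]
    refine mul_le_mul_of_nonneg_left ?_ vonMangoldt_nonneg
    rw [← Nat.floor_div_eq_div (K := ℝ)]
    exact (Nat.lt_floor_add_one _).le
  refine le_of_mul_le_mul_left (a := (N : ℝ)) ?_ hN0
  linarith

open ArithmeticFunction in
/-- Smooth numbers satisfy `Ψ(X, Y) log X ≥ ∑_{d ≤ Y} Λ(d) Ψ(X / d, Y)`: expand
`log n = ∑_{d ∣ n} Λ(d)` over the smooth `n ≤ X`. -/
theorem sum_vonMangoldt_mul_smoothCount_le {X Y : ℝ} (hX : 1 ≤ X) {D : Finset ℕ}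
    (hD : ∀ d ∈ D, 0 < d ∧ (d : ℝ) ≤ Y) :
    ∑ d ∈ D, vonMangoldt d * smoothCount (X / d) Y ≤ smoothCount X Y * Real.log X := by
  classical
  let S := (Finset.Icc 1 ⌊X⌋₊).filter (fun n : ℕ => IsSmooth Y n)
  have hS : smoothCount X Y = S.card := by rw [smoothCount]
  have h1 : ∑ n ∈ S, Real.log n ≤ smoothCount X Y * Real.log X := by
    rw [hS, ← nsmul_eq_mul, ← Finset.sum_const]
    refine Finset.sum_le_sum fun n hn => ?_
    have hn' := Finset.mem_Icc.1 (Finset.mem_filter.1 hn).1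
    have : 0 < n := hn'.1
    exact Real.log_le_log (by exact_mod_cast this)
      ((Nat.cast_le.2 hn'.2).trans (Nat.floor_le (by linarith)))
  refine le_trans ?_ h1
  calc ∑ d ∈ D, vonMangoldt d * smoothCount (X / d) Y
      ≤ ∑ d ∈ D, vonMangoldt d * (S.filter (fun n => d ∣ n)).card := by
        refine Finset.sum_le_sum fun d hd => ?_
        by_cases hp : IsPrimePow d
        · refine mul_le_mul_of_nonneg_left ?_ vonMangoldt_nonneg
          rw [smoothCount, Nat.cast_le]
          refine Finset.card_le_card_of_injOn (fun m => d * m) ?_ ?_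
          · intro m hm
            simp only [Finset.coe_filter, Finset.mem_Icc, Set.mem_ofPred_eq] at hm
            obtain ⟨⟨hm1, hmX⟩, hm0, hms⟩ := hm
            have hd0 : (0 : ℝ) < d := by exact_mod_cast (hD d hd).1
            have h2 : ((d * m : ℕ) : ℝ) ≤ X := by
              have h3 : (m : ℝ) ≤ X / d := (Nat.le_floor_iff (by positivity)).1 hmX
              rw [le_div_iff₀ hd0] at h3
              push_cast; linarith
            simp only [S, Finset.coe_filter, Finset.mem_filter, Finset.mem_Icc,
              Set.mem_ofPred_eq]
            refine ⟨⟨⟨Nat.mul_pos (hD d hd).1 hm1, Nat.le_floor h2⟩,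
              Nat.mul_ne_zero (hD d hd).1.ne' hm0, fun q hq hqd => ?_⟩, Dvd.intro m rfl⟩
            rcases (Nat.Prime.dvd_mul hq).1 hqd with h | h
            · exact (Nat.cast_le.2 (Nat.le_of_dvd (hD d hd).1 h)).trans (hD d hd).2
            · exact hms q hq h
          · intro m _ m' _ h
            exact Nat.eq_of_mul_eq_mul_left (hD d hd).1 h
        · rw [vonMangoldt_eq_zero_iff.2 hp, zero_mul, zero_mul]
    _ = ∑ n ∈ S, ∑ d ∈ D.filter (fun d => d ∣ n), vonMangoldt d := by
        simp only [Finset.sum_filter, Finset.card_filter, Nat.cast_sum, Finset.mul_sum]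
        rw [Finset.sum_comm]
        refine Finset.sum_congr rfl fun n _ => Finset.sum_congr rfl fun d _ => ?_
        split_ifs <;> simp
    _ ≤ ∑ n ∈ S, Real.log n := by
        refine Finset.sum_le_sum fun n hn => ?_
        rw [← vonMangoldt_sum]
        refine Finset.sum_le_sum_of_subset_of_nonneg ?_ fun _ _ _ => vonMangoldt_nonneg
        intro d hd
        have hn' := Finset.mem_Icc.1 (Finset.mem_filter.1 hn).1
        exact Nat.mem_divisors.2 ⟨(Finset.mem_filter.1 hd).2, by omega⟩

theorem half_le_smoothCount_of_le {X Y : ℝ} (hX : 1 ≤ X) (hXY : X ≤ Y) :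
    X / 2 ≤ smoothCount X Y := by
  classical
  have h1 : smoothCount X Y = ⌊X⌋₊ := by
    rw [smoothCount, Finset.filter_true_of_mem, Nat.card_Icc, Nat.add_sub_cancel]
    intro n hn
    rw [Finset.mem_Icc] at hn
    refine ⟨by omega, fun q _ hqn => ?_⟩
    have h2 : q ≤ ⌊X⌋₊ := (Nat.le_of_dvd (by omega) hqn).trans hn.2
    exact ((Nat.cast_le.2 h2).trans (Nat.floor_le (by linarith))).trans hXY
  rw [h1]
  have h2 := Nat.lt_floor_add_one X
  have h3 : (1 : ℝ) ≤ ⌊X⌋₊ := by exact_mod_cast (Nat.one_le_floor_iff X).2 hX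
  linarith

open ArithmeticFunction in
/-- Iteration of `Ψ(X, Y) log X ≥ ∑ Λ(d) Ψ(X / d, Y)` over `Y ^ (1 - δ) < d ≤ Y`, with `Y = exp v`: each step
divides `X` by at least `Y ^ (1 - δ)` and costs a factor `δ / (2 v)`. -/
theorem smoothCount_ge_of_sum_vonMangoldt {v δ : ℝ} (hv : 1 ≤ v) (hδ : 0 < δ) (hδ1 : δ < 1)
    (hM : δ * v / 2 ≤ ∑ d ∈ Finset.Ioc ⌊Real.exp ((1 - δ) * v)⌋₊ ⌊Real.exp v⌋₊,
      vonMangoldt d / d) (n : ℕ) :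
    ∀ X : ℝ, 1 ≤ X → Real.log X ≤ v ^ 2 → Real.log X ≤ v * (1 + n * (1 - δ)) →
      X / 2 * (δ / (2 * v)) ^ n ≤ smoothCount X (Real.exp v) := by
  have hA0 : 0 ≤ δ / (2 * v) := by positivity
  have hA1 : δ / (2 * v) ≤ 1 := by
    rw [div_le_one (by positivity)]; linarith
  have hbase : ∀ (n : ℕ) (X : ℝ), 1 ≤ X → Real.log X ≤ v →
      X / 2 * (δ / (2 * v)) ^ n ≤ smoothCount X (Real.exp v) := by
    intro n X hX hXv
    have h1 : X ≤ Real.exp v := by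
      rw [← Real.exp_log (show 0 < X by linarith)]; exact Real.exp_le_exp.2 hXv
    refine le_trans ?_ (half_le_smoothCount_of_le hX h1)
    exact mul_le_of_le_one_right (by linarith) (pow_le_one₀ hA0 hA1)
  induction n with
  | zero =>
    intro X hX _ h
    exact hbase 0 X hX (by simpa using h)
  | succ n ih =>
    intro X hX hX2 hXn
    rcases le_total (Real.log X) v with h | h
    · exact hbase _ X hX h
    have hX0 : 0 < X := by linarith
    have hlog : 0 < Real.log X := by linarith
    have hXY : Real.exp v ≤ X := by
      rw [← Real.exp_log hX0]; exact Real.exp_le_exp.2 h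
    have hrec := sum_vonMangoldt_mul_smoothCount_le hX (Y := Real.exp v)
      (D := Finset.Ioc ⌊Real.exp ((1 - δ) * v)⌋₊ ⌊Real.exp v⌋₊) (fun d hd => by
        rw [Finset.mem_Ioc] at hd
        exact ⟨by omega, (Nat.cast_le.2 hd.2).trans (Nat.floor_le (Real.exp_pos v).le)⟩)
    have hlow : X / 2 * (δ / (2 * v)) ^ n * (δ * v / 2) ≤
        smoothCount X (Real.exp v) * Real.log X := by
      refine le_trans ?_ hrec
      refine (mul_le_mul_of_nonneg_left hM (by positivity)).trans ?_
      rw [Finset.mul_sum]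
      refine Finset.sum_le_sum fun d hd => ?_
      rw [Finset.mem_Ioc] at hd
      have hd0 : (0 : ℝ) < d := by
        have : 0 < d := by omega
        exact_mod_cast this
      have hdY : (d : ℝ) ≤ Real.exp v :=
        (Nat.cast_le.2 hd.2).trans (Nat.floor_le (Real.exp_pos v).le)
      have hdl : Real.exp ((1 - δ) * v) ≤ d := ((Nat.floor_lt (Real.exp_pos _).le).1 hd.1).le
      have hlogd : (1 - δ) * v ≤ Real.log d := by
        rw [← Real.log_exp ((1 - δ) * v)]; exact Real.log_le_log (Real.exp_pos _) hdl
      have hlogXd : Real.log (X / d) = Real.log X - Real.log d :=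
        Real.log_div hX0.ne' hd0.ne'
      have h1 := ih (X / d) ((one_le_div hd0).2 (hdY.trans hXY))
        (by rw [hlogXd]; nlinarith) (by rw [hlogXd]; push_cast at hXn; nlinarith)
      calc X / 2 * (δ / (2 * v)) ^ n * (vonMangoldt d / d)
          = vonMangoldt d * (X / d / 2 * (δ / (2 * v)) ^ n) := by ring
        _ ≤ _ := mul_le_mul_of_nonneg_left h1 vonMangoldt_nonneg
    refine le_of_mul_le_mul_right ?_ hlog
    refine le_trans ?_ hlow
    have h2 : δ / (2 * v) * Real.log X ≤ δ * v / 2 := by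
      calc δ / (2 * v) * Real.log X ≤ δ / (2 * v) * v ^ 2 :=
            mul_le_mul_of_nonneg_left hX2 hA0
        _ = δ * v / 2 := by field_simp
    calc X / 2 * (δ / (2 * v)) ^ (n + 1) * Real.log X
        = X / 2 * (δ / (2 * v)) ^ n * (δ / (2 * v) * Real.log X) := by ring
      _ ≤ _ := mul_le_mul_of_nonneg_left h2 (by positivity)

open ArithmeticFunction in
theorem eventually_sum_vonMangoldt_div_ge {δ : ℝ} (hδ : 0 < δ) (hδ1 : δ < 1) :
    ∀ᶠ v : ℝ in atTop,
      δ * v / 2 ≤ ∑ d ∈ Finset.Ioc ⌊Real.exp ((1 - δ) * v)⌋₊ ⌊Real.exp v⌋₊,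
        vonMangoldt d / d := by
  filter_upwards [eventually_ge_atTop 1, eventually_ge_atTop (2 * (Real.log 4 + 6) / δ)] with
    v hv hv2
  rw [div_le_iff₀ hδ] at hv2
  have hle : ⌊Real.exp ((1 - δ) * v)⌋₊ ≤ ⌊Real.exp v⌋₊ :=
    Nat.floor_le_floor (Real.exp_le_exp.2 (by nlinarith))
  have h1 : 1 ≤ ⌊Real.exp v⌋₊ := Nat.one_le_floor_iff _ |>.2 (Real.one_le_exp (by linarith))
  have h1' : 1 ≤ ⌊Real.exp ((1 - δ) * v)⌋₊ :=
    Nat.one_le_floor_iff _ |>.2 (Real.one_le_exp (by nlinarith))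
  have hsplit := Finset.sum_Ioc_consecutive (fun d : ℕ => vonMangoldt d / (d : ℝ))
    (Nat.zero_le _) hle
  have hlow := log_sub_one_le_sum_vonMangoldt_div h1
  have hup := sum_vonMangoldt_div_le ⌊Real.exp ((1 - δ) * v)⌋₊
  have h2 : Real.log (⌊Real.exp ((1 - δ) * v)⌋₊ : ℕ) ≤ (1 - δ) * v := by
    calc _ ≤ Real.log (Real.exp ((1 - δ) * v)) :=
          Real.log_le_log (by exact_mod_cast h1') (Nat.floor_le (Real.exp_pos _).le)
      _ = _ := Real.log_exp _
  have h3 : v - 1 ≤ Real.log (⌊Real.exp v⌋₊ : ℕ) := by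
    rw [← Real.log_exp (v - 1)]
    refine Real.log_le_log (Real.exp_pos _) ?_
    have h4 := Nat.lt_floor_add_one (Real.exp v)
    have h5 : (1 : ℝ) ≤ ⌊Real.exp v⌋₊ := by exact_mod_cast h1
    have h6 : Real.exp (v - 1) * 2 ≤ Real.exp v := by
      have : Real.exp v = Real.exp (v - 1) * Real.exp 1 := by rw [← Real.exp_add]; congr 1; ring
      rw [this]
      exact mul_le_mul_of_nonneg_left (by linarith [Real.exp_one_gt_d9]) (Real.exp_pos _).le
    linarith
  linarith

/-- The lower bound `Ψ(X, Y) ≥ X u^{-(1 + o(1)) u}` in the range `Y = exp √(log X)`, where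
`u = √(log X)`. -/
theorem eventually_smoothCount_ge {η : ℝ} (hη : 0 < η) :
    ∀ᶠ v : ℝ in atTop, Real.exp (v ^ 2 - (1 + η) * (v * Real.log v)) ≤
      smoothCount (Real.exp (v ^ 2)) (Real.exp v) := by
  obtain ⟨δ, hδ⟩ : ∃ δ : ℝ, δ = η / (2 + η) := ⟨_, rfl⟩
  have hδ0 : 0 < δ := by rw [hδ]; positivity
  have hδ1 : δ < 1 := by rw [hδ, div_lt_one (by positivity)]; linarith
  have hδη : 1 / (1 - δ) = 1 + η / 2 := by
    rw [hδ]; field_simp; ring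
  obtain ⟨K, hK⟩ : ∃ K : ℝ, K = Real.log (2 / δ) := ⟨_, rfl⟩
  have hK0 : 0 < K := by
    rw [hK]; exact Real.log_pos (by rw [one_lt_div hδ0]; linarith)
  filter_upwards [eventually_sum_vonMangoldt_div_ge hδ0 hδ1, eventually_ge_atTop 1,
    eventually_ge_atTop (8 / η), eventually_ge_atTop (8 * (K + 1) / η),
    Real.tendsto_log_atTop.eventually_ge_atTop 1,
    Real.tendsto_log_atTop.eventually_ge_atTop (8 * (K * (1 + η / 2)) / η)] with
    v hM hv hv1 hv2 hl1 hl2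
  rw [div_le_iff₀ hη] at hv1 hv2 hl2
  have hv0 : 0 < v := by linarith
  let n := ⌈v / (1 - δ)⌉₊
  have hn1 : v / (1 - δ) ≤ n := Nat.le_ceil _
  have hn2 : (n : ℝ) ≤ v * (1 + η / 2) + 1 := by
    have h1 : (n : ℝ) < v / (1 - δ) + 1 :=
      Nat.ceil_lt_add_one (div_nonneg hv0.le (by linarith))
    rw [div_eq_mul_one_div, hδη] at h1
    exact h1.le
  rw [div_le_iff₀ (by linarith)] at hn1
  have h1 := smoothCount_ge_of_sum_vonMangoldt hv hδ0 hδ1 hM n (Real.exp (v ^ 2))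
    (Real.one_le_exp (by positivity)) (by rw [Real.log_exp]) (by rw [Real.log_exp]; nlinarith)
  refine le_trans ?_ h1
  have h2 : δ / (2 * v) = Real.exp (-(K + Real.log v)) := by
    rw [Real.exp_neg, Real.exp_add, hK, Real.exp_log (by positivity), Real.exp_log hv0]
    field_simp
  have h3 : Real.exp (-1) ≤ 1 / 2 := by
    rw [Real.exp_neg, ← one_div]
    exact one_div_le_one_div_of_le (by norm_num) (by linarith [Real.exp_one_gt_d9])
  calc Real.exp (v ^ 2 - (1 + η) * (v * Real.log v))
      ≤ Real.exp (v ^ 2 + -1 + n * -(K + Real.log v)) := by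
        rw [Real.exp_le_exp]
        have h4 : n * (K + Real.log v) ≤ (v * (1 + η / 2) + 1) * (K + Real.log v) :=
          mul_le_mul_of_nonneg_right hn2 (by linarith)
        have h5 := mul_le_mul_of_nonneg_right hv1 (show 0 ≤ Real.log v by linarith)
        have h6 := mul_le_mul_of_nonneg_left hl2 hv0.le
        have h7 : (v * η) * 1 ≤ (v * η) * Real.log v :=
          mul_le_mul_of_nonneg_left hl1 (by positivity)
        nlinarith
    _ = Real.exp (v ^ 2) * Real.exp (-1) * Real.exp (-(K + Real.log v)) ^ n := by
        rw [Real.exp_add, Real.exp_add, Real.exp_nat_mul]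
    _ ≤ Real.exp (v ^ 2) / 2 * (δ / (2 * v)) ^ n := by
        rw [h2]
        refine mul_le_mul_of_nonneg_right ?_ (by positivity)
        rw [div_eq_mul_one_div]
        exact mul_le_mul_of_nonneg_left h3 (Real.exp_pos _).le

/-! ### The lower bound -/

theorem eventually_smoothCount_div_le {Δ : ℤ} (hSP : SmoothShiftedPrimesConjecture Δ) :
    ∃ C : ℝ, 0 < C ∧ ∀ᶠ v : ℝ in atTop,
      smoothCount (Real.exp (v ^ 2)) (Real.exp v) / v ^ 2 ≤
        C * shiftedSmoothPrimeCount Δ (Real.exp (v ^ 2)) (Real.exp v) := by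
  have h := hSP (fun v => Real.exp (v ^ 2)) (fun v => Real.exp v)
    (Real.tendsto_exp_atTop.comp (tendsto_pow_atTop (by norm_num))) Real.tendsto_exp_atTop
    (by
      filter_upwards [eventually_ge_atTop 1] with v hv
      exact Real.exp_le_exp.2 (by nlinarith))
    (by
      refine tendsto_const_nhds.congr' ?_
      filter_upwards [eventually_gt_atTop 0] with v hv
      rw [Real.log_exp, Real.log_exp, Real.sqrt_sq hv.le]
      field_simp)
  obtain ⟨C, hC, hb⟩ := h.exists_pos
  refine ⟨C, hC, ?_⟩
  filter_upwards [hb.bound] with v hv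
  rw [Real.log_exp, Real.norm_of_nonneg (by positivity), Real.norm_of_nonneg (by positivity)] at hv
  exact hv

/-- By the pigeonhole principle, one dyadic block contains at least a `v ^ (-3)` portion of the primes
counted by `Π*`, so these may be taken of nearly equal size. -/
theorem eventually_exists_dyadic_primes {Δ : ℤ} (hSP : SmoothShiftedPrimesConjecture Δ)
    {η : ℝ} (hη : 0 < η) :
    ∀ᶠ v : ℝ in atTop, ∃ (k : ℕ) (P : Finset ℕ),
      Real.exp (v ^ 2 - (1 + 3 * η) * (v * Real.log v)) ≤ P.card ∧
      ∀ p ∈ P, p.Prime ∧ 2 ^ k ≤ p ∧ p < 2 ^ (k + 1) ∧ (p : ℝ) ≤ Real.exp (v ^ 2) ∧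
        IsSmooth (Real.exp v) ((p : ℤ) - jacobiSym Δ p).toNat := by
  obtain ⟨C, hC, hb⟩ := eventually_smoothCount_div_le hSP
  filter_upwards [hb, eventually_smoothCount_ge hη, eventually_ge_atTop 1,
    Real.tendsto_log_atTop.eventually_ge_atTop (3 / η),
    Real.tendsto_log_atTop.eventually_ge_atTop 1, eventually_ge_atTop C,
    eventually_ge_atTop 3] with v h1 h2 h3 h4 h5 h6 h7
  classical
  have hv0 : 0 < v := by linarith
  let Q := (Finset.Icc 1 ⌊Real.exp (v ^ 2)⌋₊).filter
    (fun p : ℕ => p.Prime ∧ IsSmooth (Real.exp v) ((p : ℤ) - jacobiSym Δ p).toNat)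
  have hQ : shiftedSmoothPrimeCount Δ (Real.exp (v ^ 2)) (Real.exp v) = Q.card := by
    rw [shiftedSmoothPrimeCount]
  have hQle : ∀ p ∈ Q, (p : ℝ) ≤ Real.exp (v ^ 2) := fun p hp =>
    (Nat.cast_le.2 (Finset.mem_Icc.1 (Finset.mem_filter.1 hp).1).2).trans
      (Nat.floor_le (Real.exp_pos _).le)
  have hQp : ∀ p ∈ Q, p.Prime := fun p hp => (Finset.mem_filter.1 hp).2.1
  -- `v ^ 3 ≤ exp (η v log v)` absorbs both polynomial losses.
  have h8 : v ^ 3 ≤ Real.exp (η * (v * Real.log v)) := by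
    have h9 : (3 : ℝ) * Real.log v = Real.log (v ^ 3) := by rw [Real.log_pow]; norm_num
    rw [← Real.exp_log (show 0 < v ^ 3 by positivity), Real.exp_le_exp, ← h9]
    have h10 : 3 ≤ η * v := by
      have : Real.log v ≤ v := (Real.log_le_self hv0.le)
      rw [div_le_iff₀ hη] at h4
      nlinarith
    nlinarith
  have hcard : Real.exp (v ^ 2 - (1 + 2 * η) * (v * Real.log v)) ≤ Q.card := by
    rw [hQ, div_le_iff₀ (by positivity)] at h1
    have h9 : C * v ^ 2 ≤ Real.exp (η * (v * Real.log v)) := by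
      refine le_trans ?_ h8
      rw [pow_succ' v 2]
      exact mul_le_mul_of_nonneg_right h6 (by positivity)
    have h10 : Real.exp (v ^ 2 - (1 + η) * (v * Real.log v)) ≤
        Q.card * Real.exp (η * (v * Real.log v)) := by
      refine h2.trans (h1.trans ?_)
      calc C * Q.card * v ^ 2 = Q.card * (C * v ^ 2) := by ring
        _ ≤ _ := mul_le_mul_of_nonneg_left h9 (by positivity)
    rw [show v ^ 2 - (1 + η) * (v * Real.log v) =
      v ^ 2 - (1 + 2 * η) * (v * Real.log v) + η * (v * Real.log v) by ring, Real.exp_add] at h10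
    exact le_of_mul_le_mul_right h10 (Real.exp_pos _)
  obtain ⟨J, hJ⟩ : ∃ J : ℕ, J = ⌊2 * v ^ 2⌋₊ + 1 := ⟨_, rfl⟩
  have hJv : (J : ℝ) ≤ v ^ 3 := by
    have := Nat.floor_le (show 0 ≤ 2 * v ^ 2 by positivity)
    rw [hJ]; push_cast
    nlinarith [mul_le_mul_of_nonneg_right h7 (show 0 ≤ v ^ 2 by positivity)]
  have hmap : ∀ p ∈ Q, Nat.log 2 p ∈ Finset.range J := by
    intro p hp
    have hp0 : p ≠ 0 := (hQp p hp).ne_zero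
    have h9 : (2 : ℝ) ^ Nat.log 2 p ≤ Real.exp (v ^ 2) := by
      refine le_trans ?_ (hQle p hp)
      exact_mod_cast Nat.pow_log_le_self 2 hp0
    have h10 := Real.log_le_log (by positivity) h9
    rw [Real.log_exp, Real.log_pow] at h10
    have h11 : (Nat.log 2 p : ℝ) ≤ 2 * v ^ 2 := by
      nlinarith [Real.log_two_gt_d9, Nat.cast_nonneg (α := ℝ) (Nat.log 2 p)]
    rw [Finset.mem_range, hJ, Nat.lt_succ_iff]
    exact Nat.le_floor h11
  have hJ0 : (Finset.range J).Nonempty := ⟨0, Finset.mem_range.2 (by omega)⟩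
  obtain ⟨k, _, hk⟩ := Finset.exists_le_card_fiber_of_nsmul_le_card_of_maps_to (M := ℝ)
    (b := Real.exp (v ^ 2 - (1 + 3 * η) * (v * Real.log v))) hmap hJ0 (by
      rw [Finset.card_range]
      refine le_trans ?_ hcard
      rw [show v ^ 2 - (1 + 2 * η) * (v * Real.log v) =
        η * (v * Real.log v) + (v ^ 2 - (1 + 3 * η) * (v * Real.log v)) by ring, Real.exp_add]
      rw [nsmul_eq_mul]
      exact mul_le_mul_of_nonneg_right (hJv.trans h8) (Real.exp_pos _).le)
  refine ⟨k, _, hk, fun p hp => ?_⟩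
  obtain ⟨hpQ, rfl⟩ := Finset.mem_filter.1 hp
  exact ⟨hQp p hpQ, Nat.pow_log_le_self 2 (hQp p hpQ).ne_zero,
    Nat.lt_pow_succ_log_self (by norm_num) p, hQle p hpQ, (Finset.mem_filter.1 hpQ).2.2⟩

theorem dvd_factorial_pow {n B K : ℕ} (hn : n ≠ 0) (hB : ∀ q : ℕ, q.Prime → q ∣ n → q ≤ B)
    (hK : n < 2 ^ (K + 1)) : n ∣ B.factorial ^ K := by
  rw [← Nat.factorization_prime_le_iff_dvd hn (pow_ne_zero _ (Nat.factorial_ne_zero B))]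
  intro q hq
  rw [Nat.factorization_pow, Finsupp.smul_apply, smul_eq_mul]
  by_cases hqn : q ∣ n
  · have h1 : 1 ≤ B.factorial.factorization q :=
      (hq.dvd_iff_one_le_factorization (Nat.factorial_ne_zero B)).1
        ((hq.dvd_factorial).2 (hB q hq hqn))
    have h2 : n.factorization q < K + 1 := by
      rw [← Nat.pow_lt_pow_iff_right (a := 2) (by norm_num)]
      refine lt_of_le_of_lt ?_ hK
      exact (Nat.pow_le_pow_left hq.two_le _).trans
        (Nat.le_of_dvd (Nat.pos_of_ne_zero hn) (Nat.ordProj_dvd n q))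
    calc n.factorization q ≤ K * 1 := by omega
      _ ≤ _ := Nat.mul_le_mul_left K h1
  · rw [Nat.factorization_eq_zero_of_not_dvd hqn]; exact Nat.zero_le _

/-- The common multiple is a power of a factorial, of size `exp (exp ((1 + o(1)) v))`. -/
theorem exists_common_multiple_of_smooth {v : ℝ} (hv : 1 ≤ v) :
    ∃ M : ℕ, 0 < M ∧ Real.log M ≤ (2 * v ^ 2 + 2) * (v * Real.exp v) ∧
      ∀ n : ℕ, IsSmooth (Real.exp v) n → (n : ℝ) ≤ Real.exp (v ^ 2) + 1 → n ∣ M := by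
  let B := ⌊Real.exp v⌋₊
  let K := ⌈2 * v ^ 2⌉₊ + 1
  have hB1 : 1 ≤ B := Nat.one_le_floor_iff _ |>.2 (Real.one_le_exp (by linarith))
  have hBle : (B : ℝ) ≤ Real.exp v := Nat.floor_le (Real.exp_pos v).le
  have hK1 : 2 * v ^ 2 + 1 ≤ K := by
    have := Nat.le_ceil (2 * v ^ 2)
    simp only [K]; push_cast; linarith
  have hK2 : (K : ℝ) ≤ 2 * v ^ 2 + 2 := by
    have := (Nat.ceil_lt_add_one (show 0 ≤ 2 * v ^ 2 by positivity)).le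
    simp only [K]; push_cast; linarith
  refine ⟨B.factorial ^ K, by positivity, ?_, ?_⟩
  · push_cast
    rw [Real.log_pow]
    refine mul_le_mul hK2 ?_ (Real.log_natCast_nonneg _) (by positivity)
    calc Real.log (B.factorial : ℕ) ≤ Real.log ((B : ℝ) ^ B) :=
          Real.log_le_log (by positivity) (by exact_mod_cast Nat.factorial_le_pow B)
      _ = B * Real.log B := Real.log_pow _ _
      _ ≤ Real.exp v * v := by
          refine mul_le_mul hBle ?_ (Real.log_natCast_nonneg _) (Real.exp_pos v).le
          calc Real.log B ≤ Real.log (Real.exp v) :=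
                Real.log_le_log (by exact_mod_cast hB1) hBle
            _ = v := Real.log_exp v
      _ = _ := mul_comm _ _
  · intro n hn hnX
    refine dvd_factorial_pow hn.1 (fun q hq hqn => Nat.le_floor (hn.2 q hq hqn)) ?_
    have h1 : Real.exp (v ^ 2) ≤ (2 : ℝ) ^ (2 * v ^ 2) := by
      rw [Real.rpow_def_of_pos (by norm_num), Real.exp_le_exp]
      nlinarith [Real.log_two_gt_d9, sq_nonneg v]
    have h2 : (n : ℝ) ≤ (2 : ℝ) ^ (K : ℝ) := by
      calc (n : ℝ) ≤ Real.exp (v ^ 2) + 1 := hnX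
        _ ≤ (2 : ℝ) ^ (2 * v ^ 2) * 2 := by linarith [Real.one_le_exp (sq_nonneg v)]
        _ = (2 : ℝ) ^ (2 * v ^ 2 + 1) := by
            rw [Real.rpow_add (by norm_num), Real.rpow_one]
        _ ≤ _ := Real.rpow_le_rpow_of_exponent_le (by norm_num) hK1
    rw [Real.rpow_natCast] at h2
    have h3 : n ≤ 2 ^ K := by exact_mod_cast h2
    exact lt_of_le_of_lt h3 (Nat.pow_lt_pow_right (by norm_num) (Nat.lt_succ_self K))

/-- If all primes of `P` divide `u_M`, then every product `d` of `r` distinct primes of `P` divides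
`gcd(M d, u_{M d})`. -/
theorem choose_mul_le_sum_gcd_pow {a₁ a₂ : ℤ} {l M k r N : ℕ} {P : Finset ℕ} (hM : 0 < M)
    (hP : ∀ p ∈ P, p.Prime) (hPk : ∀ p ∈ P, 2 ^ k ≤ p) (hPk' : ∀ p ∈ P, p ≤ 2 ^ (k + 1))
    (hPM : ∀ p ∈ P, (p : ℤ) ∣ lucasSeq a₁ a₂ M) (hN : M * 2 ^ ((k + 1) * r) ≤ N) :
    ((P.card.choose r : ℕ) : ℝ) * ((2 : ℝ) ^ (k * r)) ^ l ≤
      ∑ n ∈ Finset.Icc 1 N, (Int.gcd (n : ℤ) (lucasSeq a₁ a₂ n) : ℝ) ^ l := by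
  classical
  have hinj : Set.InjOn (fun s : Finset ℕ => M * ∏ p ∈ s, p) (P.powersetCard r) := by
    intro s hs t ht h
    rw [Finset.mem_coe, Finset.mem_powersetCard] at hs ht
    rw [← Nat.primeFactors_prod fun p hp => hP p (hs.1 hp),
      ← Nat.primeFactors_prod fun p hp => hP p (ht.1 hp)]
    exact congrArg _ (Nat.eq_of_mul_eq_mul_left hM h)
  have hsub : (P.powersetCard r).image (fun s : Finset ℕ => M * ∏ p ∈ s, p) ⊆
      Finset.Icc 1 N := by
    intro n hn
    obtain ⟨s, hs, rfl⟩ := Finset.mem_image.1 hn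
    rw [Finset.mem_powersetCard] at hs
    have hpos : 0 < ∏ p ∈ s, p := Finset.prod_pos fun p hp => (hP p (hs.1 hp)).pos
    have hle : ∏ p ∈ s, p ≤ (2 ^ (k + 1)) ^ r := by
      rw [← hs.2]
      exact Finset.prod_le_pow_card _ _ _ fun p hp => hPk' p (hs.1 hp)
    rw [← pow_mul] at hle
    exact Finset.mem_Icc.2 ⟨Nat.mul_pos hM hpos, (Nat.mul_le_mul_left M hle).trans hN⟩
  refine le_trans ?_ (Finset.sum_le_sum_of_subset_of_nonneg hsub fun n _ _ => by positivity)
  rw [Finset.sum_image hinj, ← Finset.card_powersetCard, ← nsmul_eq_mul, ← Finset.sum_const]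
  refine Finset.sum_le_sum fun s hs => ?_
  rw [Finset.mem_powersetCard] at hs
  refine pow_le_pow_left₀ (by positivity) ?_ l
  have hpos : 0 < ∏ p ∈ s, p := Finset.prod_pos fun p hp => (hP p (hs.1 hp)).pos
  have h1 : 2 ^ (k * r) ≤ ∏ p ∈ s, p := by
    rw [pow_mul, ← hs.2]
    exact Finset.pow_card_le_prod _ _ _ fun p hp => hPk p (hs.1 hp)
  have h2 : ((∏ p ∈ s, p : ℕ) : ℤ) ∣ lucasSeq a₁ a₂ (M * ∏ p ∈ s, p) := by
    refine dvd_lucasSeq_mul ?_ _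
    rw [Int.natCast_dvd]
    exact Finset.prod_primes_dvd _ (fun p hp => (hP p (hs.1 hp)).prime)
      fun p hp => Int.natCast_dvd.1 (hPM p (hs.1 hp))
  have h3 : ∏ p ∈ s, p ≤ Int.gcd ((M * ∏ p ∈ s, p : ℕ) : ℤ)
      (lucasSeq a₁ a₂ (M * ∏ p ∈ s, p)) := by
    refine Nat.le_of_dvd (Int.gcd_pos_of_ne_zero_left _ ?_) ?_
    · exact_mod_cast (Nat.mul_pos hM hpos).ne'
    · exact Int.dvd_gcd (Int.natCast_dvd_natCast.2 (Dvd.intro_left M rfl)) h2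
  exact_mod_cast h1.trans h3

theorem div_pow_le_choose {n r : ℕ} {L : ℝ} (hrL : (r : ℝ) ≤ L) (hr : 2 * r ≤ n) :
    ((n : ℝ) / (2 * L)) ^ r ≤ (n.choose r : ℕ) := by
  have h1 := Nat.pow_le_choose (α := ℝ) r n
  refine le_trans ?_ h1
  have h2 : ((r.factorial : ℕ) : ℝ) ≤ L ^ r :=
    le_trans (by exact_mod_cast Nat.factorial_le_pow r)
      (pow_le_pow_left₀ (Nat.cast_nonneg r) hrL r)
  have h3 : (n : ℝ) / 2 ≤ ((n + 1 - r : ℕ) : ℝ) := by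
    rw [Nat.cast_sub (by omega)]
    have : (2 : ℝ) * r ≤ n := by exact_mod_cast hr
    push_cast; linarith
  rw [← div_div, div_pow]
  exact div_le_div₀ (by positivity) (pow_le_pow_left₀ (by positivity) h3 r) (by positivity) h2

/-- With `ℓ = log₂ x` and `v = (1 - η) ℓ`: the logarithm of the common multiple of the smooth numbers and
the length of a block are negligible against `log L(x)`. -/
theorem mul_exp_le_logRatio {l : ℕ} {η ℓ : ℝ} (hη : 0 ≤ η) (hη1 : η < 1)
    (hv : 4 ≤ (1 - η) * ℓ) (h4 : 8 * ((l : ℝ) + 1) * ℓ ^ 4 ≤ η * Real.exp (η * ℓ))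
    (h5 : 1 ≤ Real.log ℓ) :
    ((l : ℝ) + 1) * ((2 * ((1 - η) * ℓ) ^ 2 + 2) * ((1 - η) * ℓ * Real.exp ((1 - η) * ℓ)) +
      (((1 - η) * ℓ) ^ 2 + 1) * Real.exp ((1 - η) * ℓ)) ≤
      η * (Real.log ℓ / ℓ) * Real.exp ℓ := by
  have hℓ0 : 0 < ℓ := pos_of_mul_pos_right (by linarith) (by linarith : 0 ≤ 1 - η)
  have hexp : Real.exp ℓ = Real.exp (η * ℓ) * Real.exp ((1 - η) * ℓ) := by
    rw [← Real.exp_add]; congr 1; ring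
  obtain ⟨v, hvdef⟩ : ∃ v, v = (1 - η) * ℓ := ⟨_, rfl⟩
  have hvℓ : v ≤ ℓ := by
    have := mul_nonneg hη hℓ0.le
    linarith
  rw [← hvdef] at hv hexp ⊢
  have hv0 : 0 < v := by linarith
  have h7 : 2 * v ^ 3 + 2 * v + v ^ 2 + 1 ≤ 8 * ℓ ^ 3 := by
    have h8 : v ^ 3 ≤ ℓ ^ 3 := pow_le_pow_left₀ hv0.le hvℓ 3
    have h9 : v ^ 2 * 4 ≤ v ^ 3 := by
      rw [pow_succ v 2]; exact mul_le_mul_of_nonneg_left hv (by positivity)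
    have h10 : v * 4 ≤ v ^ 2 := by
      rw [sq]; exact mul_le_mul_of_nonneg_left hv hv0.le
    linarith
  have h8 : η * Real.exp (η * ℓ) * 1 ≤ η * Real.exp (η * ℓ) * Real.log ℓ :=
    mul_le_mul_of_nonneg_left h5 (by positivity)
  have h9 : ((l : ℝ) + 1) * (8 * ℓ ^ 3) ≤ η * Real.exp (η * ℓ) * (Real.log ℓ / ℓ) := by
    rw [mul_div_assoc', le_div_iff₀ hℓ0]
    linarith
  calc ((l : ℝ) + 1) * ((2 * v ^ 2 + 2) * (v * Real.exp v) + (v ^ 2 + 1) * Real.exp v)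
      = ((l : ℝ) + 1) * (2 * v ^ 3 + 2 * v + v ^ 2 + 1) * Real.exp v := by ring
    _ ≤ ((l : ℝ) + 1) * (8 * ℓ ^ 3) * Real.exp v :=
        mul_le_mul_of_nonneg_right (mul_le_mul_of_nonneg_left h7 (by positivity))
          (Real.exp_pos v).le
    _ ≤ η * Real.exp (η * ℓ) * (Real.log ℓ / ℓ) * Real.exp v :=
        mul_le_mul_of_nonneg_right h9 (Real.exp_pos v).le
    _ = _ := by rw [hexp]; ring

/-- With `ℓ = log₂ x` and `v = (1 - η) ℓ`: the logarithmic loss incurred by one prime of size about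
`exp (v ^ 2)`, compared with `log₃ x / log₂ x` times the logarithm of that prime. -/
theorem loss_per_prime_le {l : ℕ} {η ℓ : ℝ} (hη : 0 < η) (hη1 : η ≤ 1 / 4) (hℓ4 : 4 ≤ ℓ)
    (hℓl : (l : ℝ) + 3 ≤ ℓ) (h5 : 2 / (η * (1 - η) ^ 3) ≤ Real.log ℓ) :
    (l : ℝ) + 3 + ℓ + (1 + 3 * η) * ((1 - η) * ℓ * Real.log ((1 - η) * ℓ)) ≤
      (1 + 10 * η) * (Real.log ℓ / ℓ) * ((1 - η) * ((1 - η) * ℓ) ^ 2) := by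
  have hη' : 0 < 1 - η := by linarith
  have hℓ0 : 0 < ℓ := by linarith
  have hlog : 0 < Real.log ℓ := Real.log_pos (by linarith)
  have h8 : Real.log ℓ / ℓ * ((1 - η) * ((1 - η) * ℓ) ^ 2) = (1 - η) ^ 3 * (ℓ * Real.log ℓ) := by
    field_simp
  rw [mul_assoc (1 + 10 * η), h8]
  have h9 : (l : ℝ) + 3 + ℓ ≤ η * (1 - η) ^ 3 * (ℓ * Real.log ℓ) := by
    rw [div_le_iff₀ (by positivity)] at h5
    have := mul_le_mul_of_nonneg_left h5 hℓ0.le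
    linarith
  have h10 : (1 + 3 * η) * ((1 - η) * ℓ * Real.log ((1 - η) * ℓ)) ≤
      (1 + 9 * η) * ((1 - η) ^ 3 * (ℓ * Real.log ℓ)) := by
    have h11 : (1 - η) * ℓ * Real.log ((1 - η) * ℓ) ≤ (1 - η) * ℓ * Real.log ℓ := by
      refine mul_le_mul_of_nonneg_left (Real.log_le_log (by positivity) ?_) (by positivity)
      have := mul_pos hη hℓ0
      linarith
    have h12 : 1 + 3 * η ≤ (1 + 9 * η) * (1 - η) ^ 2 := by
      have : 0 ≤ η * (4 - 17 * η + 9 * η ^ 2) :=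
        mul_nonneg hη.le (by nlinarith [sq_nonneg (1 / 4 - η)])
      linarith
    calc (1 + 3 * η) * ((1 - η) * ℓ * Real.log ((1 - η) * ℓ))
        ≤ (1 + 3 * η) * ((1 - η) * ℓ * Real.log ℓ) :=
          mul_le_mul_of_nonneg_left h11 (by positivity)
      _ ≤ (1 + 9 * η) * (1 - η) ^ 2 * ((1 - η) * ℓ * Real.log ℓ) :=
          mul_le_mul_of_nonneg_right h12 (by positivity)
      _ = _ := by ring
  linarith

set_option maxHeartbeats 1000000 in
/-- The lower half of the asymptotic formula. -/
theorem eventually_sum_gcd_pow_ge {a₁ a₂ : ℤ} (ha : IsUnit a₂)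
    (hSP : SmoothShiftedPrimesConjecture (lucasDisc a₁ a₂)) (l : ℕ) {η : ℝ} (hη : 0 < η)
    (hη1 : η ≤ 1 / 4) :
    ∀ᶠ x : ℝ in atTop, x ^ ((l : ℝ) + 1 - (1 + 11 * η) * logRatio x) ≤
      ∑ n ∈ Finset.Icc 1 ⌊x⌋₊, (Int.gcd (n : ℤ) (lucasSeq a₁ a₂ n) : ℝ) ^ l := by
  have hη' : 0 < 1 - η := by linarith
  have hv : Tendsto (fun x : ℝ => (1 - η) * Real.log (Real.log x)) atTop atTop :=
    tendsto_log_log.const_mul_atTop hη'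
  have e2 : ∀ᶠ v : ℝ in atTop, (1 + 3 * η) * Real.log v ≤ η * v := by
    filter_upwards [tendsto_log_div_self.eventually
      (gt_mem_nhds (show (0 : ℝ) < η / (1 + 3 * η) by positivity)), eventually_gt_atTop 0]
      with v h1 h2
    rw [div_lt_div_iff₀ h2 (by positivity)] at h1
    linarith
  have e4 : ∀ᶠ ℓ : ℝ in atTop, 8 * ((l : ℝ) + 1) * ℓ ^ 4 ≤ η * Real.exp (η * ℓ) := by
    have := (isLittleO_pow_exp_pos_mul_atTop 4 hη).bound
      (show 0 < η / (8 * ((l : ℝ) + 1)) by positivity)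
    filter_upwards [this, eventually_gt_atTop 0] with ℓ h h0
    rw [Real.norm_of_nonneg (by positivity), Real.norm_of_nonneg (by positivity),
      div_mul_eq_mul_div, le_div_iff₀ (by positivity)] at h
    linarith
  filter_upwards [hv.eventually (eventually_exists_dyadic_primes hSP hη), hv.eventually e2,
    hv.eventually_ge_atTop 4, tendsto_log_log.eventually e4,
    tendsto_log_log.eventually_ge_atTop ((l : ℝ) + 3),
    (Real.tendsto_log_atTop.comp tendsto_log_log).eventually_ge_atTop (2 / (η * (1 - η) ^ 3)),
    (Real.tendsto_log_atTop.comp tendsto_log_log).eventually_ge_atTop 1,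
    Real.tendsto_log_atTop.eventually_ge_atTop 1, eventually_ge_atTop 2] with
    x hprimes h2 hv4 h4 hℓl h5 h5' hL hx
  simp only [Function.comp] at h5 h5'
  have hx0 : 0 < x := by linarith
  set ℓ := Real.log (Real.log x) with hℓ
  have hexp : Real.exp ℓ = Real.log x := Real.exp_log (by linarith)
  set L := Real.log x with hLdef
  set v := (1 - η) * ℓ with hvdef
  have hℓ4 : 4 ≤ ℓ := by nlinarith
  have hvℓ : v ≤ ℓ := by nlinarith
  have hℓ0 : 0 < ℓ := by linarith
  have hv0 : 0 < v := by linarith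
  obtain ⟨k, P, hcard, hP⟩ := hprimes
  obtain ⟨M, hM0, hMlog, hMdvd⟩ := exists_common_multiple_of_smooth (v := v) (by linarith)
  have hlow : (1 - η) * v ^ 2 ≤ v ^ 2 - (1 + 3 * η) * (v * Real.log v) := by
    have := mul_le_mul_of_nonneg_left h2 hv0.le
    linarith
  have hcard' : Real.exp ((1 - η) * v ^ 2) ≤ P.card := (Real.exp_le_exp.2 hlow).trans hcard
  have hv3 : 3 * v ≤ (1 - η) * v ^ 2 := by
    have : 3 * 1 ≤ (1 - η) * v := by
      calc (3 : ℝ) * 1 = (3 / 4) * 4 := by norm_num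
        _ ≤ (1 - η) * v := mul_le_mul (by linarith) hv4 (by norm_num) hη'.le
    nlinarith
  have hℓv : ℓ + 1 ≤ (1 - η) * v ^ 2 := by
    have : (3 / 4) * ℓ ≤ v := mul_le_mul_of_nonneg_right (by linarith) hℓ0.le
    linarith
  have hP2L : 2 * L ≤ P.card := by
    refine le_trans ?_ ((Real.exp_le_exp.2 hℓv).trans hcard')
    rw [Real.exp_add, hexp]
    have := Real.exp_one_gt_d9
    nlinarith
  have hPne : P.Nonempty := by
    rw [← Finset.card_pos]
    have : (0 : ℝ) < P.card := by linarith
    exact_mod_cast this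
  -- `P` lies in a block of `2 ^ k` integers, so its primes are at least `#P`.
  have hPk : (P.card : ℝ) ≤ (2 : ℝ) ^ k := by
    have h6 : P ⊆ Finset.Ico (2 ^ k) (2 ^ (k + 1)) := fun p hp =>
      Finset.mem_Ico.2 ⟨(hP p hp).2.1, (hP p hp).2.2.1⟩
    have h7 := Finset.card_le_card h6
    rw [Nat.card_Ico, pow_succ, mul_two, Nat.add_sub_cancel] at h7
    exact_mod_cast h7
  have hkX : (2 : ℝ) ^ k ≤ Real.exp (v ^ 2) := by
    obtain ⟨p, hp⟩ := hPne
    refine le_trans ?_ (hP p hp).2.2.2.1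
    exact_mod_cast (hP p hp).2.1
  have hPM : ∀ p ∈ P, (p : ℤ) ∣ lucasSeq a₁ a₂ M := by
    intro p hp
    obtain ⟨hpp, hp1, hp2, hpX, hps⟩ := hP p hp
    have hp3 : p ≠ 2 := by
      rintro rfl
      have h6 : (2 : ℝ) ^ k ≤ 2 := by exact_mod_cast hp1
      have h7 : Real.exp (ℓ + 1) ≤ 2 := ((Real.exp_le_exp.2 hℓv).trans hcard').trans (hPk.trans h6)
      linarith [Real.add_one_le_exp (ℓ + 1)]
    refine dvd_lucasSeq_of_dvd (prime_dvd_lucasSeq ha hpp hp3) (hMdvd _ hps ?_)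
    have h6 : ((p : ℤ) - jacobiSym (lucasDisc a₁ a₂) p).toNat ≤ p + 1 := by
      rcases jacobiSym.trichotomy (lucasDisc a₁ a₂) p with h | h | h <;> rw [h] <;> omega
    have h7 : ((((p : ℤ) - jacobiSym (lucasDisc a₁ a₂) p).toNat : ℕ) : ℝ) ≤ p + 1 := by
      exact_mod_cast h6
    linarith
  obtain ⟨w, hw⟩ : ∃ w : ℝ, w = ((k : ℝ) + 1) * Real.log 2 := ⟨_, rfl⟩
  have hl2 := Real.log_two_gt_d9
  have hl2' := Real.log_two_lt_d9
  have hkw : (k : ℝ) * Real.log 2 = w - Real.log 2 := by rw [hw]; ring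
  have hw1 : w ≤ v ^ 2 + 1 := by
    have h6 := Real.log_le_log (by positivity) hkX
    rw [Real.log_exp, Real.log_pow] at h6
    linarith
  have hw2 : (1 - η) * v ^ 2 ≤ w := by
    have h6 := Real.log_le_log (Real.exp_pos _) (hcard'.trans hPk)
    rw [Real.log_exp, Real.log_pow] at h6
    linarith
  have hw0 : 0 < w := lt_of_lt_of_le (by linarith) hw2
  -- The size of the common multiple is negligible: `log M ≤ (log x) ^ (1 - η + o(1))`.
  have hMw : ((l : ℝ) + 1) * (Real.log M + w) ≤ η * logRatio x * L := by
    have h6 := mul_exp_le_logRatio (l := l) hη.le (by linarith) hv4 h4 h5'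
    rw [← hvdef, hexp] at h6
    refine le_trans (mul_le_mul_of_nonneg_left ?_ (by positivity)) h6
    have h7 : v ^ 2 + 1 ≤ (v ^ 2 + 1) * Real.exp v :=
      le_mul_of_one_le_right (by positivity) (Real.one_le_exp hv0.le)
    linarith
  obtain ⟨r, hr⟩ : ∃ r : ℕ, r = ⌊(L - Real.log M) / w⌋₊ := ⟨_, rfl⟩
  have hκ0 : 0 < logRatio x := div_pos (by linarith) hℓ0
  have hML : Real.log M ≤ L := by
    have h6 : η * logRatio x * L ≤ 1 * L := by
      refine mul_le_mul_of_nonneg_right ?_ (by linarith)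
      have h7 : logRatio x ≤ 1 := by
        rw [logRatio, ← hℓ, div_le_one hℓ0]; exact Real.log_le_self hℓ0.le
      nlinarith
    have h7 : 0 ≤ (l : ℝ) * (Real.log M + w) :=
      mul_nonneg (Nat.cast_nonneg l) (add_nonneg (Real.log_natCast_nonneg M) hw0.le)
    linarith
  have hr1 : r * w ≤ L - Real.log M := by
    rw [← le_div_iff₀ hw0, hr]
    exact Nat.floor_le (div_nonneg (by linarith) hw0.le)
  have hr2 : L - Real.log M - w ≤ r * w := by
    have := Nat.lt_floor_add_one ((L - Real.log M) / w)
    rw [← hr, div_lt_iff₀ hw0] at this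
    linarith
  have hrL' : r * w ≤ L := by linarith [Real.log_natCast_nonneg M]
  have hrL : (r : ℝ) ≤ L := by
    have : (1 : ℝ) ≤ w := by linarith
    exact (le_mul_of_one_le_right (Nat.cast_nonneg r) this).trans hrL'
  have hNle : M * 2 ^ ((k + 1) * r) ≤ ⌊x⌋₊ := by
    refine Nat.le_floor ?_
    push_cast
    have hM0' : (0 : ℝ) < M := by exact_mod_cast hM0
    rw [← Real.log_le_log_iff (by positivity) hx0, Real.log_mul hM0'.ne' (by positivity),
      Real.log_pow]
    push_cast
    have : ((k : ℝ) + 1) * r * Real.log 2 = r * w := by rw [hw]; ring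
    linarith
  have hmain := choose_mul_le_sum_gcd_pow (l := l) hM0 (fun p hp => (hP p hp).1)
    (fun p hp => (hP p hp).2.1) (fun p hp => (hP p hp).2.2.1.le) hPM hNle
  refine le_trans ?_ hmain
  have hchoose := div_pow_le_choose (n := P.card) hrL (by
    have : (2 : ℝ) * r ≤ P.card := by linarith
    exact_mod_cast this)
  refine le_trans ?_ (mul_le_mul_of_nonneg_right hchoose (by positivity))
  have hPpos : (0 : ℝ) < P.card := by linarith
  rw [← Real.log_le_log_iff (by positivity) (by positivity), Real.log_rpow hx0,
    Real.log_mul (by positivity) (by positivity), Real.log_pow, Real.log_pow, Real.log_pow,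
    Real.log_div hPpos.ne' (by positivity), Real.log_mul (by norm_num) (by linarith), ← hLdef,
    ← hℓ]
  have hlogP : w - 1 - (1 + 3 * η) * (v * Real.log v) ≤ Real.log P.card := by
    have h6 := Real.log_le_log (Real.exp_pos _) hcard
    rw [Real.log_exp] at h6
    linarith
  have hr0 : (0 : ℝ) ≤ r := Nat.cast_nonneg r
  have hl0 : (0 : ℝ) ≤ l := Nat.cast_nonneg l
  -- `r ≤ log x / ((1 - η) v ^ 2)` turns the loss of each of the `r` primes into the total loss.
  have hloss : r * ((l : ℝ) + 3 + ℓ + (1 + 3 * η) * (v * Real.log v)) ≤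
      (1 + 10 * η) * logRatio x * L := by
    have h6 : (r : ℝ) * ((1 - η) * v ^ 2) ≤ L :=
      (mul_le_mul_of_nonneg_left hw2 hr0).trans hrL'
    have h7 := loss_per_prime_le hη hη1 hℓ4 hℓl h5
    rw [← hvdef] at h7
    change _ ≤ (1 + 10 * η) * logRatio x * ((1 - η) * v ^ 2) at h7
    calc r * ((l : ℝ) + 3 + ℓ + (1 + 3 * η) * (v * Real.log v))
        ≤ r * ((1 + 10 * η) * logRatio x * ((1 - η) * v ^ 2)) := mul_le_mul_of_nonneg_left h7 hr0
      _ = (1 + 10 * η) * logRatio x * (r * ((1 - η) * v ^ 2)) := by ring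
      _ ≤ _ := mul_le_mul_of_nonneg_left h6 (by positivity)
  have hfin1 : r * (w - 1 - (1 + 3 * η) * (v * Real.log v) - (Real.log 2 + ℓ)) ≤
      r * (Real.log P.card - (Real.log 2 + ℓ)) := mul_le_mul_of_nonneg_left (by linarith) hr0
  have hfin2 : (l : ℝ) * (((k * r : ℕ) : ℝ) * Real.log 2) = l * (r * w) - l * r * Real.log 2 := by
    push_cast
    rw [show (l : ℝ) * ((k : ℝ) * r * Real.log 2) = l * r * (k * Real.log 2) by ring, hkw]
    ring
  rw [hfin2]
  have hfin3 : ((l : ℝ) + 1) * (L - Real.log M - w) ≤ (l + 1) * (r * w) :=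
    mul_le_mul_of_nonneg_left hr2 (by positivity)
  have hfin4 : (l : ℝ) * r * Real.log 2 ≤ l * r * 1 :=
    mul_le_mul_of_nonneg_left (by linarith) (by positivity)
  have hfin5 : r * Real.log 2 ≤ r * 1 := mul_le_mul_of_nonneg_left (by linarith) hr0
  linarith

/-! ### The asymptotic formula -/

/-- Two-sided bounds with exponents `A - (1 ∓ δ) * logRatio x`, for every small `δ`, amount to an
equality with an exponent `A - (1 + o(1)) * logRatio x`. -/
theorem exists_tendsto_zero_rpow_eq {S : ℝ → ℝ} {A : ℝ}
    (hup : ∀ δ : ℝ, 0 < δ → δ ≤ 1 → ∀ᶠ x : ℝ in atTop, S x ≤ x ^ (A - (1 - δ) * logRatio x))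
    (hlow : ∀ δ : ℝ, 0 < δ → δ ≤ 1 → ∀ᶠ x : ℝ in atTop, x ^ (A - (1 + δ) * logRatio x) ≤ S x) :
    ∃ ε : ℝ → ℝ, Tendsto ε atTop (𝓝 0) ∧
      ∀ᶠ x : ℝ in atTop, S x = x ^ (A - (1 + ε x) * logRatio x) := by
  refine ⟨fun x => (A - Real.log (S x) / Real.log x) / logRatio x - 1, ?_, ?_⟩
  · rw [Metric.tendsto_nhds]
    intro δ' hδ'
    obtain ⟨δ, hδ⟩ : ∃ δ, δ = min (δ' / 2) 1 := ⟨_, rfl⟩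
    have hδ0 : 0 < δ := by rw [hδ]; positivity
    have hδ1 : δ ≤ 1 := hδ ▸ min_le_right _ _
    have hδδ' : δ < δ' := by
      have : δ ≤ δ' / 2 := hδ ▸ min_le_left _ _
      linarith
    filter_upwards [hup δ hδ0 hδ1, hlow δ hδ0 hδ1, eventually_logRatio_pos,
      eventually_gt_atTop 1] with x h1 h2 hκ hx
    have hx0 : 0 < x := by linarith
    have hL : 0 < Real.log x := Real.log_pos hx
    have hS : 0 < S x := lt_of_lt_of_le (Real.rpow_pos_of_pos hx0 _) h2
    have h3 := Real.log_le_log hS h1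
    have h4 := Real.log_le_log (Real.rpow_pos_of_pos hx0 _) h2
    rw [Real.log_rpow hx0] at h3 h4
    rw [← div_le_iff₀ hL] at h3
    rw [← le_div_iff₀ hL] at h4
    rw [Real.dist_eq, sub_zero]
    refine lt_of_le_of_lt (abs_le.2 ⟨?_, ?_⟩) hδδ'
    · rw [le_sub_iff_add_le, le_div_iff₀ hκ]; linarith
    · rw [sub_le_iff_le_add, div_le_iff₀ hκ]; linarith
  · filter_upwards [hlow 1 one_pos le_rfl, eventually_logRatio_pos, eventually_gt_atTop 1] with
      x h2 hκ hx
    have hx0 : 0 < x := by linarith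
    have hL : 0 < Real.log x := Real.log_pos hx
    have hS : 0 < S x := lt_of_lt_of_le (Real.rpow_pos_of_pos hx0 _) h2
    rw [show A - (1 + ((A - Real.log (S x) / Real.log x) / logRatio x - 1)) * logRatio x =
      Real.log (S x) / Real.log x by field_simp; ring, Real.rpow_def_of_pos hx0,
      mul_div_cancel₀ _ hL.ne', Real.exp_log hS]

theorem theorem1p3 (a₁ a₂ : ℤ) (hu : IsNondegenerateLucas a₁ a₂) (ha₂ : a₂ = 1 ∨ a₂ = -1)
    (l : ℕ) (hl : 0 < l)
    (hGP : GordonPomeranceConjecture a₁ a₂)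
    (hSP : SmoothShiftedPrimesConjecture (lucasDisc a₁ a₂)) :
    ∃ ε : ℝ → ℝ, Tendsto ε atTop (𝓝 0) ∧
      ∀ᶠ x : ℝ in atTop,
        ∑ n ∈ Finset.Icc (1 : ℕ) ⌊x⌋₊, (Int.gcd (n : ℤ) (lucasSeq a₁ a₂ n) : ℝ) ^ l =
          x ^ ((l : ℝ) + 1 -
            (1 + ε x) * Real.log (Real.log (Real.log x)) / Real.log (Real.log x)) := by
  have ha : IsUnit a₂ := Int.isUnit_iff.2 ha₂
  obtain ⟨ε, hε, h⟩ := exists_tendsto_zero_rpow_eq (A := (l : ℝ) + 1)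
    (S := fun x => ∑ n ∈ Finset.Icc 1 ⌊x⌋₊, (Int.gcd (n : ℤ) (lucasSeq a₁ a₂ n) : ℝ) ^ l)
    (fun δ h0 h1 => by
      have := eventually_sum_gcd_pow_le ha hu.lucasDisc_ne_zero hGP hl (ε := δ / 8)
        (by positivity) (by linarith)
      filter_upwards [this, eventually_logRatio_pos, eventually_ge_atTop 1] with x h2 hκ hx
      refine h2.trans (Real.rpow_le_rpow_of_exponent_le hx ?_)
      have := mul_pos h0 hκ
      linarith)
    (fun δ h0 h1 => by
      have := eventually_sum_gcd_pow_ge ha hSP l (η := δ / 11) (by positivity) (by linarith)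
      filter_upwards [this] with x h2
      rwa [show 11 * (δ / 11) = δ by ring] at h2)
  refine ⟨ε, hε, ?_⟩
  filter_upwards [h] with x hx
  rw [hx, logRatio, mul_div_assoc]
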